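/- Consider one major agent (index $0$) and $n$ minor agents (indices $i \in N=\{1,\dots,n\}$), $N_0=\{0\}\cup N$, over a horizon $T\ge 1$, with states $x_i(t)\in\mathbb R^{d_x^i}$ and controls $u_i(t)\in\mathbb R^{d_u^i}$. With $x=\mathrm{vec}(x_0,\dots,x_n)$ and similarly $u,w$, the dynamics are $$x(t+1)=Ax(t)+Bu(t)+w(t),$$ where the only blocks of $A$ and $B$ that may be nonzero are $A_{ii},B_{ii}$ ($i\in N_0$) and $A_{i0},B_{i0}$ ($i\in N$). Minor agent $i\in N$ has the output $y_i(t)=C_{ii}x_i(t)+v_i(t)$. The primitive random variables $x_i(1)$, $w_i(t)$ ($i\in N_0$) and $v_i(t)$ ($i\in N$), $1\le t\le T$, are independent, have zero mean and finite variance (they need not be Gaussian). The information available to the agents at time $t$ is $$I_0(t)=\{x_0(1{:}t),u_0(1{:}t-1)\},\qquad I_i(t)=\{x_0(1{:}t),y_i(1{:}t),u_0(1{:}t-1),u_i(1{:}t-1)\},\ i\in N,$$ and a general strategy $g$ consists of measurable functions $g_{i,t}$ with $u_i(t)=g_{i,t}(I_i(t))$, $i\in N_0$. Its cost is $$J(g)=\mathbb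 E\Big[\sum_{t=1}^{T-1}\big(x(t)^\top Qx(t)+u(t)^\top Ru(t)\big)+x(T)^\top Q_Tx(T)\Big]\in[0,\infty],$$ with $Q,Q_T$ symmetric positive semidefinite and $R$ symmetric positive definite. A strategy is optimal if it minimizes $J$ over all general strategies. Let $\mathcal R(P,A,B,Q,R)=Q+A^\top PA-A^\top PB(R+B^\top PB)^{-1}B^\top PA$ and $\mathcal G(P,A,B,R)=(R+B^\top PB)^{-1}B^\top PA$. Put $S^c(T)=Q_T$, $S^\ell_i(T)=[Q_T]_{ii}$ and, for $t=T-1,\dots,1$ and $i\in N$, $$S^c(t)=\mathcal R(S^c(t+1),A,B,Q,R),\quad S^\ell_i(t)=\mathcal R(S^\ell_i(t+1),A_{ii},B_{ii},Q_{ii},R_{ii}),$$ $$L^c(t)=\mathcal G(S^c(t+1),A,B,R),\quad L^\ell_i(t)=\mathcal G(S^\ell_i(t+1),A_{ii},B_{ii},R_{ii}).$$ Let $I^c(t)=I_0(t)$ be the common information. For a strategy with integrable controls put $u^c(t)=\mathbb E[u(t)\mid I^c(t)]$, $u^\ell(t)=u(t)-u^c(t)$, and $$x^c(1)=0,\ x^c(t+1)=Ax^c(t)+Bu^c(t);\quad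 x^\ell(1)=0,\ x^\ell(t+1)=Ax^\ell(t)+Bu^\ell(t);\quad x^s(1)=x(1),\ x^s(t+1)=Ax^s(t)+w(t);$$ $$z^c(t)=x^c(t)+x^s(t),\quad z^\ell_i(t)=x^\ell_i(t)+x^s_i(t),$$ $$\hat z^c(t)=\mathbb E[z^c(t)\mid I^c(t)],\quad \hat z^\ell_i(t)=\mathbb E[z^\ell_i(t)\mid I_i(t)]-\mathbb E[z^\ell_i(t)\mid I_0(t)].$$ **Theorem.** An optimal general strategy exists and has finite cost. A general strategy is optimal if and only if, for every $t\in\{1,\dots,T-1\}$, its control $u(t)$ is integrable and, almost surely, $$u^c(t)=-L^c(t)\,\hat z^c(t)\qquad\text{and}\qquad u^\ell_i(t)=-L^\ell_i(t)\,\hat z^\ell_i(t)\quad (i\in N).$$ The optimal strategy is unique: any two optimal strategies $g,g'$ generate almost surely the same controls $u(t)$, $1\le t\le T-1$, and for these $t$ and all $i \in N_0$ one has $g_{i,t}=g'_{i,t}$ almost everywhere with respect to the distribution of $I_i(t)$ under $g$. -/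

import Mathlib

open MeasureTheory ProbabilityTheory
open scoped ENNReal Matrix

noncomputable section

namespace MajorMinor

/-- Agents: `none` is the major agent (agent `0`), `some i` is a minor agent. -/
abbrev Agent (n : ℕ) := Option (Fin n)

/-- Stacked vectors `vec(x_0, …, x_n)` with blocks of dimensions `d 0, …, d n`. -/
abbrev Stacked {n : ℕ} (d : Agent n → ℕ) := (Σ i, Fin (d i)) → ℝ

/-- Block matrices with row blocks of sizes `d i` and column blocks of sizes `e j`. -/
abbrev BlockMatrix {n : ℕ} (d e : Agent n → ℕ) := Matrix (Σ i, Fin (d i)) (Σ j, Fin (e j)) ℝ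

/-- The `i`-th block of a stacked vector. -/
def blk {n : ℕ} {d : Agent n → ℕ} (x : Stacked d) (i : Agent n) : Fin (d i) → ℝ :=
  fun a => x ⟨i, a⟩

/-- The diagonal block `M_{ii}`. -/
def diagBlk {n : ℕ} {d e : Agent n → ℕ} (M : BlockMatrix d e) (i : Agent n) :
    Matrix (Fin (d i)) (Fin (e i)) ℝ :=
  M.submatrix (fun a => ⟨i, a⟩) (fun a => ⟨i, a⟩)

/-- The Riccati operator
`Q + Aᵀ P A - Aᵀ P B (R + Bᵀ P B)⁻¹ Bᵀ P A`. -/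
def riccatiOp {k l : Type*} [Fintype k] [Fintype l] [DecidableEq l]
    (P A : Matrix k k ℝ) (B : Matrix k l ℝ) (Q : Matrix k k ℝ) (R : Matrix l l ℝ) :
    Matrix k k ℝ :=
  Q + Aᵀ * P * A - Aᵀ * P * B * (R + Bᵀ * P * B)⁻¹ * Bᵀ * P * A

/-- The gain operator `(R + Bᵀ P B)⁻¹ Bᵀ P A`. -/
def gainOp {k l : Type*} [Fintype k] [Fintype l] [DecidableEq l]
    (P A : Matrix k k ℝ) (B : Matrix k l ℝ) (R : Matrix l l ℝ) : Matrix l k ℝ :=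
  (R + Bᵀ * P * B)⁻¹ * Bᵀ * P * A

/-- The Riccati recursion with `k` steps to go, starting from the terminal weight `QT`. -/
def riccatiToGo {k l : Type*} [Fintype k] [Fintype l] [DecidableEq l]
    (A : Matrix k k ℝ) (B : Matrix k l ℝ) (Q QT : Matrix k k ℝ) (R : Matrix l l ℝ) :
    ℕ → Matrix k k ℝ
  | 0 => QT
  | m + 1 => riccatiOp (riccatiToGo A B Q QT R m) A B Q R

/-- The deterministic data of the system with one major and `n` minor agents.

Time is counted from `0`: index `t` stands for time `t + 1` in the convention where the first
instant is `1`. The horizon is `T = N + 1`, so that states live at `0, …, N`, decisions that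
matter for the cost are taken at `0, …, N - 1`, and `N` is the terminal instant. -/
structure System (n : ℕ) where
  /-- number of decision stages, `T - 1` -/
  N : ℕ
  dx : Agent n → ℕ
  du : Agent n → ℕ
  dy : Fin n → ℕ
  A : BlockMatrix dx dx
  B : BlockMatrix dx du
  /-- observation matrix `C_{ii}` of minor agent `i` -/
  C : ∀ i : Fin n, Matrix (Fin (dy i)) (Fin (dx (some i))) ℝ
  Q : BlockMatrix dx dx
  QT : BlockMatrix dx dx
  R : BlockMatrix du du
  /-- only the blocks `A_{ii}` and `A_{i0}` may be nonzero -/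
  A_sparse : ∀ p q, q.1 ≠ p.1 → q.1 ≠ none → A p q = 0
  /-- only the blocks `B_{ii}` and `B_{i0}` may be nonzero -/
  B_sparse : ∀ p q, q.1 ≠ p.1 → q.1 ≠ none → B p q = 0
  Q_psd : Q.PosSemidef
  QT_psd : QT.PosSemidef
  R_pd : R.PosDef

variable {n : ℕ}

/-! ### Gains -/

/-- `S^c(t)`: `S^c(N) = Q_T`, and the backward Riccati recursion for `t < N`. -/
def System.Scom (S : System n) (t : ℕ) : BlockMatrix S.dx S.dx :=
  riccatiToGo S.A S.B S.Q S.QT S.R (S.N - t)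

/-- `S^ℓ_i(t)`. -/
def System.Sloc (S : System n) (i : Fin n) (t : ℕ) :
    Matrix (Fin (S.dx (some i))) (Fin (S.dx (some i))) ℝ :=
  riccatiToGo (diagBlk S.A (some i)) (diagBlk S.B (some i)) (diagBlk S.Q (some i))
    (diagBlk S.QT (some i)) (diagBlk S.R (some i)) (S.N - t)

/-- `L^c(t)`, for `t < N`. -/
def System.Lcom (S : System n) (t : ℕ) : BlockMatrix S.du S.dx :=
  gainOp (S.Scom (t + 1)) S.A S.B S.R

/-- `L^ℓ_i(t)`, for `t < N`. -/
def System.Lloc (S : System n) (i : Fin n) (t : ℕ) :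
    Matrix (Fin (S.du (some i))) (Fin (S.dx (some i))) ℝ :=
  gainOp (S.Sloc i (t + 1)) (diagBlk S.A (some i)) (diagBlk S.B (some i)) (diagBlk S.R (some i))

/-! ### Primitive random variables -/

/-- The primitive random variables: initial states, process noises, observation noises. -/
structure Primitives (S : System n) (Ω : Type*) where
  x1 : ∀ i : Agent n, Ω → Fin (S.dx i) → ℝ
  w : ∀ i : Agent n, ℕ → Ω → Fin (S.dx i) → ℝ
  v : ∀ i : Fin n, ℕ → Ω → Fin (S.dy i) → ℝ

/-- Labels of the primitive random variables over the horizon. -/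
inductive PrimIdx (n N : ℕ) : Type
  | init (i : Agent n) : PrimIdx n N
  | process (i : Agent n) (t : Fin (N + 1)) : PrimIdx n N
  | obs (i : Fin n) (t : Fin (N + 1)) : PrimIdx n N

/-- Dimension of a primitive random variable. -/
def primDim (S : System n) : PrimIdx n S.N → ℕ
  | .init i => S.dx i
  | .process i _ => S.dx i
  | .obs i _ => S.dy i

variable {S : System n} {Ω : Type*}

/-- The primitive random variables over the horizon as one family. -/
def Primitives.fam (ξ : Primitives S Ω) : ∀ p : PrimIdx n S.N, Ω → Fin (primDim S p) → ℝ
  | .init i => ξ.x1 i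
  | .process i t => ξ.w i t
  | .obs i t => ξ.v i t

/-- The primitive random variables are independent, with zero mean and finite variance. -/
structure Primitives.Standard [MeasurableSpace Ω] (ξ : Primitives S Ω) (μ : Measure Ω) :
    Prop where
  measurable : ∀ p, Measurable (ξ.fam p)
  indep : iIndepFun ξ.fam μ
  memLp : ∀ p, MemLp (ξ.fam p) 2 μ
  mean_zero : ∀ p, ∫ ω, ξ.fam p ω ∂μ = 0

/-- `x(1) = vec(x_0(1), …, x_n(1))`. -/
def Primitives.x1vec (ξ : Primitives S Ω) (ω : Ω) : Stacked S.dx := fun p => ξ.x1 p.1 ω p.2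

/-- `w(t) = vec(w_0(t), …, w_n(t))`. -/
def Primitives.wvec (ξ : Primitives S Ω) (t : ℕ) (ω : Ω) : Stacked S.dx :=
  fun p => ξ.w p.1 t ω p.2

/-! ### Dynamics and information -/

/-- The state `x(t)` under a sequence of control inputs. -/
def Primitives.stateOf (ξ : Primitives S Ω) (us : ℕ → Stacked S.du) (ω : Ω) : ℕ → Stacked S.dx
  | 0 => ξ.x1vec ω
  | t + 1 => S.A *ᵥ ξ.stateOf us ω t + S.B *ᵥ us t + ξ.wvec t ω

/-- The output `y_i(t) = C_{ii} x_i(t) + v_i(t)` under a sequence of control inputs. -/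
def Primitives.outputOf (ξ : Primitives S Ω) (us : ℕ → Stacked S.du) (ω : Ω) (i : Fin n)
    (t : ℕ) : Fin (S.dy i) → ℝ :=
  S.C i *ᵥ blk (ξ.stateOf us ω t) (some i) + ξ.v i t ω

/-- Values of `I_0(t)`: the history of `x_0` up to `t` and of `u_0` before `t`. -/
abbrev InfoMajor (S : System n) (t : ℕ) :=
  (Fin (t + 1) → Fin (S.dx none) → ℝ) × (Fin t → Fin (S.du none) → ℝ)

/-- Values of `I_i(t)`: those of `I_0(t)`, the history of `y_i` up to `t` and of `u_i`
before `t`. -/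
abbrev InfoMinor (S : System n) (i : Fin n) (t : ℕ) :=
  InfoMajor S t × (Fin (t + 1) → Fin (S.dy i) → ℝ) × (Fin t → Fin (S.du (some i)) → ℝ)

/-- `I_0(t)` under a sequence of control inputs. -/
def Primitives.infoMajorOf (ξ : Primitives S Ω) (us : ℕ → Stacked S.du) (ω : Ω) (t : ℕ) :
    InfoMajor S t :=
  (fun s => blk (ξ.stateOf us ω s) none, fun s => blk (us s) none)

/-- `I_i(t)` under a sequence of control inputs. -/
def Primitives.infoMinorOf (ξ : Primitives S Ω) (us : ℕ → Stacked S.du) (ω : Ω) (i : Fin n)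
    (t : ℕ) : InfoMinor S i t :=
  (ξ.infoMajorOf us ω t, fun s => ξ.outputOf us ω i s, fun s => blk (us s) (some i))

/-! ### Strategies and the closed loop -/

/-- General control strategies: measurable control laws `g_{i,t}` of the information `I_i(t)`. -/
structure Strategy (S : System n) where
  major : ∀ t, InfoMajor S t → Fin (S.du none) → ℝ
  minor : ∀ (i : Fin n) (t : ℕ), InfoMinor S i t → Fin (S.du (some i)) → ℝ
  measurable_major : ∀ t, Measurable (major t)
  measurable_minor : ∀ i t, Measurable (minor i t)

/-- The action that `g` prescribes at time `t` when the inputs so far are `us`; only the values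
`us s` with `s < t` matter. -/
def Strategy.act (g : Strategy S) (ξ : Primitives S Ω) (us : ℕ → Stacked S.du) (ω : Ω)
    (t : ℕ) : Stacked S.du
  | ⟨none, a⟩ => g.major t (ξ.infoMajorOf us ω t) a
  | ⟨some i, a⟩ => g.minor i t (ξ.infoMinorOf us ω i t) a

/-- The control process `u(t)` generated by `g`; see `Strategy.control_eq`. -/
def Strategy.control (g : Strategy S) (ξ : Primitives S Ω) (t : ℕ) (ω : Ω) : Stacked S.du :=
  g.act ξ (fun s => if _h : s < t then g.control ξ s ω else 0) ω t
termination_by t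

theorem Primitives.stateOf_congr (ξ : Primitives S Ω) (ω : Ω) {us us' : ℕ → Stacked S.du} :
    ∀ {t : ℕ}, (∀ s < t, us s = us' s) → ξ.stateOf us ω t = ξ.stateOf us' ω t
  | 0, _ => rfl
  | t + 1, h => by
    simp only [Primitives.stateOf]
    rw [ξ.stateOf_congr ω (t := t) fun s hs => h s (by omega), h t (by omega)]

theorem Strategy.act_congr (g : Strategy S) (ξ : Primitives S Ω) (ω : Ω)
    {us us' : ℕ → Stacked S.du} {t : ℕ} (h : ∀ s < t, us s = us' s) :
    g.act ξ us ω t = g.act ξ us' ω t := by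
  have hst : ∀ s : Fin (t + 1), ξ.stateOf us ω s = ξ.stateOf us' ω s := fun s =>
    ξ.stateOf_congr ω fun r hr => h r (by omega)
  have hu : ∀ s : Fin t, us s = us' s := fun s => h s s.2
  have h0 : ξ.infoMajorOf us ω t = ξ.infoMajorOf us' ω t := by
    simp [Primitives.infoMajorOf, hst, hu]
  have hi : ∀ i, ξ.infoMinorOf us ω i t = ξ.infoMinorOf us' ω i t := fun i => by
    simp [Primitives.infoMinorOf, Primitives.outputOf, h0, hst, hu]
  funext p
  rcases p with ⟨_ | i, a⟩
  · simp [Strategy.act, h0]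
  · simp [Strategy.act, hi]

/-- The closed-loop equation `u_i(t) = g_{i,t}(I_i(t))`. -/
theorem Strategy.control_eq (g : Strategy S) (ξ : Primitives S Ω) (t : ℕ) (ω : Ω) :
    g.control ξ t ω = g.act ξ (fun s => g.control ξ s ω) ω t := by
  rw [Strategy.control]
  exact g.act_congr ξ ω fun s hs => by simp [hs]

/-- The closed-loop state `x(t)`. -/
def Strategy.state (g : Strategy S) (ξ : Primitives S Ω) (t : ℕ) (ω : Ω) : Stacked S.dx :=
  ξ.stateOf (fun s => g.control ξ s ω) ω t

/-- The closed-loop information `I_0(t)`, which is also the common information `I^c(t)`. -/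
def Strategy.infoMajor (g : Strategy S) (ξ : Primitives S Ω) (t : ℕ) (ω : Ω) : InfoMajor S t :=
  ξ.infoMajorOf (fun s => g.control ξ s ω) ω t

/-- The closed-loop information `I_i(t)` of minor agent `i`. -/
def Strategy.infoMinor (g : Strategy S) (ξ : Primitives S Ω) (i : Fin n) (t : ℕ) (ω : Ω) :
    InfoMinor S i t :=
  ξ.infoMinorOf (fun s => g.control ξ s ω) ω i t

/-- The sigma-algebra generated by `I_0(t) = I^c(t)`. -/
@[reducible] def Strategy.sigmaCom (g : Strategy S) (ξ : Primitives S Ω) (t : ℕ) : MeasurableSpace Ω :=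
  MeasurableSpace.comap (g.infoMajor ξ t) inferInstance

/-- The sigma-algebra generated by `I_i(t)`. -/
@[reducible] def Strategy.sigmaMinor (g : Strategy S) (ξ : Primitives S Ω) (i : Fin n) (t : ℕ) :
    MeasurableSpace Ω :=
  MeasurableSpace.comap (g.infoMinor ξ i t) inferInstance

/-! ### Cost -/

/-- The realized total cost. -/
def Strategy.pathCost (g : Strategy S) (ξ : Primitives S Ω) (ω : Ω) : ℝ :=
  ∑ t ∈ Finset.range S.N,
      (g.state ξ t ω ⬝ᵥ (S.Q *ᵥ g.state ξ t ω) + g.control ξ t ω ⬝ᵥ (S.R *ᵥ g.control ξ t ω))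
    + g.state ξ S.N ω ⬝ᵥ (S.QT *ᵥ g.state ξ S.N ω)

/-! ### Linear recursions for the state components -/

/-- The solution of `x(t+1) = A x(t) + B u(t)` with zero initial state. -/
def driven (S : System n) (u : ℕ → Ω → Stacked S.du) : ℕ → Ω → Stacked S.dx
  | 0 => fun _ => 0
  | t + 1 => fun ω => S.A *ᵥ driven S u t ω + S.B *ᵥ u t ω

/-- `x^s(t)`. -/
def Primitives.xsto (ξ : Primitives S Ω) : ℕ → Ω → Stacked S.dx
  | 0 => fun ω => ξ.x1vec ω
  | t + 1 => fun ω => S.A *ᵥ ξ.xsto t ω + ξ.wvec t ω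

variable [MeasurableSpace Ω]

/-- The expected total cost `J(g)`. The realized cost is nonnegative, so its expectation always
makes sense in `[0, ∞]`. -/
def Strategy.J (g : Strategy S) (ξ : Primitives S Ω) (μ : Measure Ω) : ℝ≥0∞ :=
  ∫⁻ ω, ENNReal.ofReal (g.pathCost ξ ω) ∂μ

/-- `g` minimizes the expected total cost over all general control strategies. -/
def Strategy.IsOptimal (g : Strategy S) (ξ : Primitives S Ω) (μ : Measure Ω) : Prop :=
  ∀ g' : Strategy S, g.J ξ μ ≤ g'.J ξ μ

/-! ### Common/local split -/

/-- `u^c(t) = E[u(t) | I^c(t)]`. -/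
def Strategy.ucom (g : Strategy S) (ξ : Primitives S Ω) (μ : Measure Ω) (t : ℕ) :
    Ω → Stacked S.du :=
  μ[g.control ξ t | g.sigmaCom ξ t]

/-- `u^ℓ(t) = u(t) - u^c(t)`. -/
def Strategy.uloc (g : Strategy S) (ξ : Primitives S Ω) (μ : Measure Ω) (t : ℕ) (ω : Ω) :
    Stacked S.du :=
  g.control ξ t ω - g.ucom ξ μ t ω

/-- `x^c(t)`. -/
def Strategy.xcom (g : Strategy S) (ξ : Primitives S Ω) (μ : Measure Ω) :
    ℕ → Ω → Stacked S.dx :=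
  driven S (g.ucom ξ μ)

/-- `x^ℓ(t)`. -/
def Strategy.xloc (g : Strategy S) (ξ : Primitives S Ω) (μ : Measure Ω) :
    ℕ → Ω → Stacked S.dx :=
  driven S (g.uloc ξ μ)

/-- `z^c(t) = x^c(t) + x^s(t)`. -/
def Strategy.zcom (g : Strategy S) (ξ : Primitives S Ω) (μ : Measure Ω) (t : ℕ) (ω : Ω) :
    Stacked S.dx :=
  g.xcom ξ μ t ω + ξ.xsto t ω

/-- `z^ℓ_i(t) = x^ℓ_i(t) + x^s_i(t)`. -/
def Strategy.zloc (g : Strategy S) (ξ : Primitives S Ω) (μ : Measure Ω) (i : Fin n) (t : ℕ)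
    (ω : Ω) : Fin (S.dx (some i)) → ℝ :=
  blk (g.xloc ξ μ t ω) (some i) + blk (ξ.xsto t ω) (some i)

/-- `ẑ^c(t) = E[z^c(t) | I^c(t)]`. -/
def Strategy.zhatCom (g : Strategy S) (ξ : Primitives S Ω) (μ : Measure Ω) (t : ℕ) :
    Ω → Stacked S.dx :=
  μ[g.zcom ξ μ t | g.sigmaCom ξ t]

/-- `ẑ^ℓ_i(t) = E[z^ℓ_i(t) | I_i(t)] - E[z^ℓ_i(t) | I_0(t)]`. -/
def Strategy.zhatLoc (g : Strategy S) (ξ : Primitives S Ω) (μ : Measure Ω) (i : Fin n) (t : ℕ) :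
    Ω → Fin (S.dx (some i)) → ℝ :=
  μ[g.zloc ξ μ i t | g.sigmaMinor ξ i t] - μ[g.zloc ξ μ i t | g.sigmaCom ξ t]

end MajorMinor

end

/-!
Controls carry no information about the noise, so the information σ-algebras are generated by
primitive random variables alone and do not depend on the strategy. Subtracting from states and
controls their conditional expectations given the common information splits them into a common part
and one local part per agent; the parts are mutually orthogonal in `L²`, because given the common
information the data of distinct agents are independent. The cost therefore splits into a common
and `n` local linear-quadratic problems, and completing the square with the Riccati matrices writes
each as a constant plus a sum of positive definite quadratic forms in the deviations from the
feedback laws. The cost is minimal exactly when all deviations vanish, and the closed loop so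
obtained has exactly one solution.
-/

noncomputable section

namespace MajorMinor

/-! ### Conditional expectation and independence -/

section CondExp

variable {Ω E : Type*} [NormedAddCommGroup E] [NormedSpace ℝ E] {m₀ : MeasurableSpace Ω}
  {μ : Measure Ω}

theorem isPiSystem_image2_inter (m₁ m₂ : MeasurableSpace Ω) :
    IsPiSystem (Set.image2 (· ∩ ·) {s | MeasurableSet[m₁] s} {s | MeasurableSet[m₂] s}) := by
  rintro _ ⟨a, ha, b, hb, rfl⟩ _ ⟨a', ha', b', hb', rfl⟩ _
  exact ⟨a ∩ a', MeasurableSet.inter ha ha', b ∩ b', MeasurableSet.inter hb hb',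
    Set.inter_inter_inter_comm ..⟩

theorem sup_eq_generateFrom_image2_inter (m₁ m₂ : MeasurableSpace Ω) :
    m₁ ⊔ m₂ = MeasurableSpace.generateFrom
      (Set.image2 (· ∩ ·) {s | MeasurableSet[m₁] s} {s | MeasurableSet[m₂] s}) := by
  refine le_antisymm (sup_le (fun s hs => ?_) fun s hs => ?_)
    (MeasurableSpace.generateFrom_le ?_)
  · exact MeasurableSpace.measurableSet_generateFrom ⟨s, hs, Set.univ, .univ, Set.inter_univ s⟩
  · exact MeasurableSpace.measurableSet_generateFrom ⟨Set.univ, .univ, s, hs, Set.univ_inter s⟩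
  · rintro _ ⟨a, ha, b, hb, rfl⟩
    exact .inter (le_sup_left (a := m₁) _ ha) (le_sup_right (a := m₁) _ hb)

theorem setIntegral_eq_of_isPiSystem {m : MeasurableSpace Ω} (hm : m ≤ m₀) {f g : Ω → E}
    (hf : Integrable f μ) (hg : Integrable g μ) {C : Set (Set Ω)}
    (hmC : m = MeasurableSpace.generateFrom C) (hC : IsPiSystem C)
    (h_univ : ∫ ω, f ω ∂μ = ∫ ω, g ω ∂μ)
    (h : ∀ s ∈ C, ∫ ω in s, f ω ∂μ = ∫ ω in s, g ω ∂μ) {s : Set Ω} (hs : MeasurableSet[m] s) :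
    ∫ ω in s, f ω ∂μ = ∫ ω in s, g ω ∂μ := by
  have apply_eq : ∀ {φ : Ω → E}, Integrable φ μ → ∀ t, MeasurableSet[m] t →
      (μ.withDensityᵥ φ).trim hm t = ∫ ω in t, φ ω ∂μ := fun hφ t ht => by
    rw [VectorMeasure.trim_measurableSet_eq hm ht, withDensityᵥ_apply hφ (hm _ ht)]
  have key : (μ.withDensityᵥ f).trim hm = (μ.withDensityᵥ g).trim hm := by
    refine VectorMeasure.ext_of_generateFrom C (fun t ht => ?_) hmC hC ?_
    · have ht' : MeasurableSet[m] t := hmC ▸ MeasurableSpace.measurableSet_generateFrom ht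
      rw [apply_eq hf t ht', apply_eq hg t ht', h t ht]
    · simpa only [apply_eq hf _ .univ, apply_eq hg _ .univ, setIntegral_univ] using h_univ
  rw [← apply_eq hf s hs, key, apply_eq hg s hs]

variable [CompleteSpace E]

theorem setIntegral_inter_of_indep [IsProbabilityMeasure μ] {m₁ m₂ : MeasurableSpace Ω}
    (h₁ : m₁ ≤ m₀) (h₂ : m₂ ≤ m₀) (hind : Indep m₁ m₂ μ) {X : Ω → E}
    (hX : StronglyMeasurable[m₁] X) (hXi : Integrable X μ) {a b : Set Ω}
    (ha : MeasurableSet[m₁] a) (hb : MeasurableSet[m₂] b) :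
    ∫ ω in a ∩ b, X ω ∂μ = μ.real b • ∫ ω in a, X ω ∂μ := by
  have ha₀ : MeasurableSet[m₀] a := h₁ _ ha
  have h_const : μ[a.indicator X | m₂] =ᵐ[μ] fun _ => ∫ ω in a, X ω ∂μ := by
    simpa only [integral_indicator ha₀] using condExp_indep_eq h₁ h₂ (hX.indicator ha) hind
  rw [Set.inter_comm, ← setIntegral_indicator ha₀,
    ← setIntegral_condExp h₂ (hXi.indicator ha₀) hb,
    setIntegral_congr_ae (h₂ _ hb) (h_const.mono fun _ h _ => h), setIntegral_const]

theorem condExp_sup_of_indep [IsProbabilityMeasure μ] {m₁ m₂ m : MeasurableSpace Ω}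
    (h₁ : m₁ ≤ m₀) (h₂ : m₂ ≤ m₀) (hm : m ≤ m₁) (hind : Indep m₁ m₂ μ)
    {X : Ω → E} (hX : StronglyMeasurable[m₁] X) :
    μ[X | m ⊔ m₂] =ᵐ[μ] μ[X | m] := by
  by_cases hXi : Integrable X μ
  swap
  · rw [condExp_of_not_integrable hXi, condExp_of_not_integrable hXi]
  have hle : m ⊔ m₂ ≤ m₀ := sup_le (hm.trans h₁) h₂
  refine (ae_eq_condExp_of_forall_setIntegral_eq hle hXi
    (fun s _ _ => integrable_condExp.integrableOn) (fun s hs _ => ?_)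
    (stronglyMeasurable_condExp.mono le_sup_left).aestronglyMeasurable).symm
  refine setIntegral_eq_of_isPiSystem hle integrable_condExp hXi
    (sup_eq_generateFrom_image2_inter m m₂) (isPiSystem_image2_inter m m₂)
    (integral_condExp (hm.trans h₁)) ?_ hs
  rintro _ ⟨a, ha, b, hb, rfl⟩
  have ha₁ : MeasurableSet[m₁] a := hm _ ha
  rw [setIntegral_inter_of_indep h₁ h₂ hind (stronglyMeasurable_condExp.mono hm)
      integrable_condExp ha₁ hb, setIntegral_inter_of_indep h₁ h₂ hind hX hXi ha₁ hb,
    setIntegral_condExp (hm.trans h₁) hXi ha]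

theorem condExp_add_of_stronglyMeasurable_left {m : MeasurableSpace Ω} (hm : m ≤ m₀)
    [SigmaFinite (μ.trim hm)] {X Y : Ω → E} (hX : StronglyMeasurable[m] X)
    (hXi : Integrable X μ) (hY : Integrable Y μ) : μ[X + Y | m] =ᵐ[μ] X + μ[Y | m] := by
  simpa only [condExp_of_stronglyMeasurable hm hX hXi] using condExp_add hXi hY m

theorem condExp_sub_condExp_ae_eq [IsFiniteMeasure μ] {m m' : MeasurableSpace Ω} (hm : m ≤ m₀)
    (hle : m' ≤ m) {K L Y : Ω → E} (hK : StronglyMeasurable[m'] K) (hL : StronglyMeasurable[m] L)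
    (hKi : Integrable K μ) (hLi : Integrable L μ) (hYi : Integrable Y μ)
    (h₀ : μ[L + Y | m'] =ᵐ[μ] 0) :
    μ[K + (L + Y) | m] - μ[K + (L + Y) | m'] =ᵐ[μ] L + μ[Y | m] := by
  have h_fine := condExp_add_of_stronglyMeasurable_left hm ((hK.mono hle).add hL) (hKi.add hLi) hYi
  rw [add_assoc] at h_fine
  filter_upwards [h_fine, h₀, condExp_add_of_stronglyMeasurable_left (hle.trans hm) hK hKi
    (hLi.add hYi)] with ω h h₀ h'
  rw [Pi.sub_apply, h, h', Pi.add_apply K, h₀]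
  simp only [Pi.add_apply, Pi.zero_apply]
  abel

theorem condExp_apply {ι : Type*} [Fintype ι] {m : MeasurableSpace Ω} {X : Ω → ι → ℝ}
    (hX : Integrable X μ) (p : ι) :
    (fun ω => (μ[X | m]) ω p) =ᵐ[μ] μ[fun ω => X ω p | m] :=
  (ContinuousLinearMap.proj (R := ℝ) (φ := fun _ : ι => ℝ) p).comp_condExp_comm hX

end CondExp

/-! ### Spaces of random vectors -/

section RandomVectors

variable {Ω : Type*} {m₀ : MeasurableSpace Ω} {ι κ : Type*}

/-- The real functions on `Ω` that are measurable for `m`. -/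
def measurableFun (m : MeasurableSpace Ω) : Submodule ℝ (Ω → ℝ) where
  carrier := {f | Measurable[m] f}
  add_mem' hf hg := hf.add hg
  zero_mem' := measurable_const
  smul_mem' c _ hf := hf.const_mul c

/-- The square-integrable real random variables (not up to almost everywhere equality). -/
def squareIntegrable (μ : Measure Ω) : Submodule ℝ (Ω → ℝ) where
  carrier := {f | MemLp f 2 μ}
  add_mem' hf hg := hf.add hg
  zero_mem' := MemLp.zero
  smul_mem' c _ hf := hf.const_smul c

/-- The square-integrable random variables that are measurable for `m` and whose conditional
expectation given `m'` vanishes. -/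
def centered (μ : Measure Ω) [IsFiniteMeasure μ] (m m' : MeasurableSpace Ω) :
    Submodule ℝ (Ω → ℝ) where
  carrier := {f | Measurable[m] f ∧ MemLp f 2 μ ∧ μ[f | m'] =ᵐ[μ] 0}
  add_mem' := by
    rintro f g ⟨hf, hf2, hf0⟩ ⟨hg, hg2, hg0⟩
    refine ⟨hf.add hg, hf2.add hg2, ?_⟩
    simpa only [add_zero] using (condExp_add (hf2.integrable one_le_two)
      (hg2.integrable one_le_two) m').trans (hf0.add hg0)
  zero_mem' := ⟨measurable_const, MemLp.zero, by rw [condExp_zero]⟩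
  smul_mem' := by
    rintro c f ⟨hf, hf2, hf0⟩
    refine ⟨hf.const_mul c, hf2.const_smul c, (condExp_smul c f m').trans ?_⟩
    simpa only [smul_zero] using hf0.const_smul c

/-- The random vectors whose `p`-th component lies in `𝒱 p` for every `p`. -/
def vec (𝒱 : ι → Submodule ℝ (Ω → ℝ)) : Submodule ℝ (Ω → ι → ℝ) where
  carrier := {X | ∀ p, (fun ω => X ω p) ∈ 𝒱 p}
  add_mem' hX hY p := (𝒱 p).add_mem (hX p) (hY p)
  zero_mem' p := (𝒱 p).zero_mem
  smul_mem' c _ hX p := (𝒱 p).smul_mem c (hX p)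

theorem vec_mono {𝒱 𝒲 : ι → Submodule ℝ (Ω → ℝ)} (h : ∀ p, 𝒱 p ≤ 𝒲 p) : vec 𝒱 ≤ vec 𝒲 :=
  fun _ hX p => h p (hX p)

theorem mulVec_mem_vec [Fintype ι] {𝒱 : ι → Submodule ℝ (Ω → ℝ)} {𝒲 : κ → Submodule ℝ (Ω → ℝ)}
    {M : Matrix κ ι ℝ} (hM : ∀ p q, M p q ≠ 0 → 𝒱 q ≤ 𝒲 p) {X : Ω → ι → ℝ} (hX : X ∈ vec 𝒱) :
    (fun ω => M *ᵥ X ω) ∈ vec 𝒲 := by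
  intro p
  have h_sum : (fun ω => (M *ᵥ X ω) p) = ∑ q, M p q • fun ω => X ω q := by
    ext ω
    simp only [Matrix.mulVec, dotProduct, Finset.sum_apply, Pi.smul_apply, smul_eq_mul]
  rw [h_sum]
  refine (𝒲 p).sum_mem fun q _ => ?_
  by_cases hq : M p q = 0
  · rw [hq, zero_smul]
    exact (𝒲 p).zero_mem
  · exact (𝒲 p).smul_mem _ (hM p q hq (hX q))

variable {μ : Measure Ω}

theorem mem_vec_measurableFun {m : MeasurableSpace Ω} {X : Ω → ι → ℝ} :
    X ∈ vec (fun _ => measurableFun m) ↔ Measurable[m] X :=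
  measurable_pi_iff.symm

theorem mem_vec_squareIntegrable [Fintype ι] {X : Ω → ι → ℝ} :
    X ∈ vec (fun _ => squareIntegrable μ) ↔ MemLp X 2 μ :=
  memLp_pi_iff.symm

theorem measurable_mulVec [Fintype ι] {m : MeasurableSpace Ω} (M : Matrix κ ι ℝ)
    {X : Ω → ι → ℝ} (hX : Measurable[m] X) : Measurable[m] fun ω => M *ᵥ X ω :=
  mem_vec_measurableFun.1 (mulVec_mem_vec (fun _ _ _ => le_rfl) (mem_vec_measurableFun.2 hX))

theorem memLp_mulVec [Fintype ι] [Fintype κ] (M : Matrix κ ι ℝ) {X : Ω → ι → ℝ}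
    (hX : MemLp X 2 μ) : MemLp (fun ω => M *ᵥ X ω) 2 μ :=
  mem_vec_squareIntegrable.1
    (mulVec_mem_vec (fun _ _ _ => le_rfl) (mem_vec_squareIntegrable.2 hX))

theorem mem_vec_inf {𝒱 𝒲 : ι → Submodule ℝ (Ω → ℝ)} {X : Ω → ι → ℝ} :
    X ∈ vec (fun p => 𝒱 p ⊓ 𝒲 p) ↔ X ∈ vec 𝒱 ∧ X ∈ vec 𝒲 :=
  forall_and

theorem centered_mono [IsFiniteMeasure μ] {m₁ m₂ : MeasurableSpace Ω} (h : m₁ ≤ m₂)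
    (m' : MeasurableSpace Ω) : centered μ m₁ m' ≤ centered μ m₂ m' :=
  fun _ hf => ⟨hf.1.mono h le_rfl, hf.2⟩

theorem ae_eq_zero_of_mem_centered_self [IsFiniteMeasure μ] {m : MeasurableSpace Ω}
    (hm : m ≤ m₀) {f : Ω → ℝ} (hf : f ∈ centered μ m m) : f =ᵐ[μ] 0 := by
  have h := hf.2.2
  rwa [condExp_of_stronglyMeasurable hm hf.1.stronglyMeasurable
    (hf.2.1.integrable one_le_two)] at h

theorem integral_mul_eq_zero_of_mem_centered [IsFiniteMeasure μ] {m m' : MeasurableSpace Ω}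
    (hm' : m' ≤ m₀) {f g : Ω → ℝ} (hf : f ∈ centered μ m m') (hg : Measurable[m'] g)
    (hg2 : MemLp g 2 μ) : ∫ ω, f ω * g ω ∂μ = 0 := by
  have h_pull : μ[f * g | m'] =ᵐ[μ] μ[f | m'] * g :=
    condExp_mul_of_stronglyMeasurable_right hg.stronglyMeasurable
      (hf.2.1.integrable_mul hg2) (hf.2.1.integrable one_le_two)
  have h_zero : μ[f * g | m'] =ᵐ[μ] 0 := by
    filter_upwards [h_pull, hf.2.2] with ω h h₀
    rw [h, Pi.mul_apply, h₀, Pi.zero_apply, zero_mul]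
  calc ∫ ω, f ω * g ω ∂μ = ∫ ω, (μ[f * g | m']) ω ∂μ := (integral_condExp hm').symm
    _ = 0 := integral_eq_zero_of_ae h_zero

theorem condExp_ae_eq_zero_of_mem_vec_centered [IsFiniteMeasure μ] [Fintype ι]
    {m : ι → MeasurableSpace Ω} {m' : MeasurableSpace Ω} {X : Ω → ι → ℝ}
    (hX : X ∈ vec fun p => centered μ (m p) m') : μ[X | m'] =ᵐ[μ] 0 := by
  have hX2 : MemLp X 2 μ := mem_vec_squareIntegrable.1 fun p => (hX p).2.1
  have h_apply : ∀ p, ∀ᵐ ω ∂μ, (μ[X | m']) ω p = 0 := fun p =>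
    (condExp_apply (hX2.integrable one_le_two) p).trans (hX p).2.2
  filter_upwards [ae_all_iff.2 h_apply] with ω h using funext h

theorem sub_condExp_mem_vec_centered [IsFiniteMeasure μ] [Fintype ι] {m : ι → MeasurableSpace Ω}
    {m' : MeasurableSpace Ω} (hm' : m' ≤ m₀) (hle : ∀ p, m' ≤ m p) {X : Ω → ι → ℝ}
    (hX : ∀ p, Measurable[m p] fun ω => X ω p) (hX2 : MemLp X 2 μ) :
    X - μ[X | m'] ∈ vec fun p => centered μ (m p) m' := by
  intro p
  have hXi : Integrable X μ := hX2.integrable one_le_two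
  have h_meas : Measurable[m'] fun ω => (μ[X | m']) ω p :=
    (measurable_pi_apply p).comp stronglyMeasurable_condExp.measurable
  refine ⟨(hX p).sub (h_meas.mono (hle p) le_rfl), (hX2.sub (hX2.condExp one_le_two)).eval p, ?_⟩
  have h_sub : μ[X - μ[X | m'] | m'] =ᵐ[μ] 0 := by
    have h := condExp_sub hXi integrable_condExp m' (g := μ[X | m'])
    rwa [condExp_of_stronglyMeasurable hm' stronglyMeasurable_condExp integrable_condExp,
      sub_self] at h
  exact (condExp_apply (hXi.sub integrable_condExp) p).symm.trans
    (h_sub.mono fun ω h => congrFun h p)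

theorem condExp_mem_vec_centered [IsFiniteMeasure μ] [Fintype ι] {m m₁ m' : MeasurableSpace Ω}
    (hm₁ : m₁ ≤ m₀) (hle : m' ≤ m₁) {X : Ω → ι → ℝ} (hX : X ∈ vec fun _ => centered μ m m') :
    μ[X | m₁] ∈ vec fun _ => centered μ m₁ m' := by
  have hX2 : MemLp X 2 μ := mem_vec_squareIntegrable.1 fun p => (hX p).2.1
  refine fun p => ⟨(measurable_pi_apply p).comp stronglyMeasurable_condExp.measurable,
    (hX2.condExp one_le_two).eval p, ?_⟩
  have h_tower : μ[μ[X | m₁] | m'] =ᵐ[μ] 0 :=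
    (condExp_condExp_of_le hle hm₁).trans (condExp_ae_eq_zero_of_mem_vec_centered hX)
  exact (condExp_apply integrable_condExp p).symm.trans (h_tower.mono fun ω h => congrFun h p)

end RandomVectors

/-! ### Expected quadratic forms -/

section ExpectedQuadraticForm

variable {Ω : Type*} {m₀ : MeasurableSpace Ω} {μ : Measure Ω} {ι κ : Type*}

/-- Orthogonality in `L²` of all components of `X` to all components of `Y`. -/
def Orth (μ : Measure Ω) (X : Ω → ι → ℝ) (Y : Ω → κ → ℝ) : Prop :=
  ∀ p q, ∫ ω, X ω p * Y ω q ∂μ = 0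

theorem Orth.symm {X : Ω → ι → ℝ} {Y : Ω → κ → ℝ} (h : Orth μ X Y) : Orth μ Y X :=
  fun p q => by simpa only [mul_comm] using h q p

variable [Fintype ι]

/-- The expected quadratic form `E[Xᵀ M X]`. -/
def expQuad (μ : Measure Ω) (M : Matrix ι ι ℝ) (X : Ω → ι → ℝ) : ℝ :=
  ∫ ω, X ω ⬝ᵥ (M *ᵥ X ω) ∂μ

theorem expQuad_congr_ae {M : Matrix ι ι ℝ} {X Y : Ω → ι → ℝ} (h : X =ᵐ[μ] Y) :
    expQuad μ M X = expQuad μ M Y :=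
  integral_congr_ae (h.mono fun ω hω => by simp only [hω])

theorem integrable_mul_apply {X Y : Ω → ι → ℝ} (hX : MemLp X 2 μ) (hY : MemLp Y 2 μ) (p q : ι) :
    Integrable (fun ω => X ω p * Y ω q) μ :=
  (hX.eval p).integrable_mul (hY.eval q)

theorem integrable_quadForm (M : Matrix ι ι ℝ) {X : Ω → ι → ℝ} (hX : MemLp X 2 μ) :
    Integrable (fun ω => X ω ⬝ᵥ (M *ᵥ X ω)) μ :=
  integrable_finsetSum _ fun p _ => integrable_mul_apply hX (memLp_mulVec M hX) p p

theorem expQuad_eq_sum (M : Matrix ι ι ℝ) {X : Ω → ι → ℝ} (hX : MemLp X 2 μ) :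
    expQuad μ M X = ∑ p, ∑ q, M p q * ∫ ω, X ω p * X ω q ∂μ := by
  have h_expand : ∀ ω, X ω ⬝ᵥ (M *ᵥ X ω) = ∑ p, ∑ q, M p q * (X ω p * X ω q) := fun ω => by
    simp only [dotProduct, Matrix.mulVec, Finset.mul_sum, mul_left_comm]
  have h_int : ∀ p q, Integrable (fun ω => M p q * (X ω p * X ω q)) μ := fun p q =>
    (integrable_mul_apply hX hX p q).const_mul _
  simp only [expQuad, h_expand]
  rw [integral_finsetSum _ fun p _ => integrable_finsetSum _ fun q _ => h_int p q]
  refine Finset.sum_congr rfl fun p _ => ?_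
  rw [integral_finsetSum _ fun q _ => h_int p q]
  simp only [integral_const_mul]

theorem expQuad_add_of_orth (M : Matrix ι ι ℝ) {X Y : Ω → ι → ℝ} (hX : MemLp X 2 μ)
    (hY : MemLp Y 2 μ) (h : Orth μ X Y) :
    expQuad μ M (X + Y) = expQuad μ M X + expQuad μ M Y := by
  have h_mul : ∀ p q, ∫ ω, (X + Y) ω p * (X + Y) ω q ∂μ
      = ∫ ω, X ω p * X ω q ∂μ + ∫ ω, Y ω p * Y ω q ∂μ := fun p q => by
    have hXX := integrable_mul_apply hX hX p q
    have hYY := integrable_mul_apply hY hY p q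
    have hX_add : Integrable (fun ω => X ω p * X ω q + X ω p * Y ω q) μ :=
      hXX.add (integrable_mul_apply hX hY p q)
    have hY_add : Integrable (fun ω => Y ω p * X ω q + Y ω p * Y ω q) μ :=
      (integrable_mul_apply hY hX p q).add hYY
    simp only [Pi.add_apply, add_mul, mul_add (X _ _), mul_add (Y _ _)]
    rw [integral_add hX_add hY_add, integral_add hXX (integrable_mul_apply hX hY p q),
      integral_add (integrable_mul_apply hY hX p q) hYY, h p q, h.symm p q, add_zero, zero_add]
  rw [expQuad_eq_sum M (hX.add hY), expQuad_eq_sum M hX, expQuad_eq_sum M hY]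
  simp only [h_mul, mul_add, Finset.sum_add_distrib]

theorem quadForm_nonneg {M : Matrix ι ι ℝ} (hM : M.PosSemidef) (x : ι → ℝ) :
    0 ≤ x ⬝ᵥ (M *ᵥ x) := by
  simpa only [star_trivial] using hM.dotProduct_mulVec_nonneg x

theorem expQuad_nonneg {M : Matrix ι ι ℝ} (hM : M.PosSemidef) (X : Ω → ι → ℝ) :
    0 ≤ expQuad μ M X :=
  integral_nonneg fun ω => quadForm_nonneg hM (X ω)

theorem expQuad_eq_zero_iff {M : Matrix ι ι ℝ} (hM : M.PosDef) {X : Ω → ι → ℝ}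
    (hX : MemLp X 2 μ) : expQuad μ M X = 0 ↔ X =ᵐ[μ] 0 := by
  rw [expQuad, integral_eq_zero_iff_of_nonneg
    (fun ω => quadForm_nonneg hM.posSemidef (X ω)) (integrable_quadForm M hX)]
  refine Filter.eventually_congr (.of_forall fun ω => ⟨fun h => ?_, fun h => ?_⟩)
  · by_contra h_ne
    exact (hM.dotProduct_mulVec_pos h_ne).ne' h
  · simp only [h, Pi.zero_apply, zero_dotProduct]

end ExpectedQuadraticForm

/-! ### The linear-quadratic problem -/

section LinearQuadratic

variable {k l : Type*} [Fintype k]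

theorem dotProduct_mulVec_comm {P : Matrix k k ℝ} (hP : P.IsHermitian) (x y : k → ℝ) :
    x ⬝ᵥ (P *ᵥ y) = y ⬝ᵥ (P *ᵥ x) := by
  rw [← Matrix.dotProduct_transpose_mulVec, show Pᵀ = P from hP]

theorem quadForm_add {P : Matrix k k ℝ} (hP : P.IsHermitian) (x y : k → ℝ) :
    (x + y) ⬝ᵥ (P *ᵥ (x + y)) = x ⬝ᵥ (P *ᵥ x) + y ⬝ᵥ (P *ᵥ y) + 2 * (y ⬝ᵥ (P *ᵥ x)) := by
  rw [Matrix.mulVec_add, add_dotProduct, dotProduct_add, dotProduct_add,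
    dotProduct_mulVec_comm hP x y]
  ring

/-- The weight `R + Bᵀ P B` of the completed square. -/
def gainWeight (P : Matrix k k ℝ) (B : Matrix k l ℝ) (R : Matrix l l ℝ) : Matrix l l ℝ :=
  R + Bᵀ * P * B

theorem gainWeight_posDef [Finite l] {P : Matrix k k ℝ} (hP : P.PosSemidef) (B : Matrix k l ℝ)
    {R : Matrix l l ℝ} (hR : R.PosDef) : (gainWeight P B R).PosDef :=
  hR.add_posSemidef (hP.conjTranspose_mul_mul_same B)

variable [Fintype l]

theorem mulVec_dotProduct_mulVec (P : Matrix k k ℝ) {m : Type*} [Fintype m] (A : Matrix k m ℝ)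
    (B : Matrix k l ℝ) (x : m → ℝ) (u : l → ℝ) :
    (A *ᵥ x) ⬝ᵥ (P *ᵥ (B *ᵥ u)) = x ⬝ᵥ ((Aᵀ * P * B) *ᵥ u) := by
  rw [dotProduct_comm, ← Matrix.dotProduct_transpose_mulVec, Matrix.mulVec_mulVec,
    Matrix.mulVec_mulVec, Matrix.mul_assoc]

variable [DecidableEq l]

theorem sq_apply_le_quadForm {R : Matrix l l ℝ} (hR : R.PosDef) (p : l) (u : l → ℝ) :
    u p ^ 2 ≤ R⁻¹ p p * (u ⬝ᵥ (R *ᵥ u)) := by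
  have hpos : 0 < R⁻¹ p p := hR.inv.diag_pos
  have hdet : IsUnit R.det := (Matrix.isUnit_iff_isUnit_det R).1 hR.isUnit
  set e : l → ℝ := Pi.single p 1
  have hRe : R *ᵥ (R⁻¹ *ᵥ e) = e := by
    rw [Matrix.mulVec_mulVec, Matrix.mul_nonsing_inv _ hdet, Matrix.one_mulVec]
  have hue : u ⬝ᵥ e = u p := by simp [e]
  have hee : (R⁻¹ *ᵥ e) ⬝ᵥ e = R⁻¹ p p := by simp [e]
  -- Cauchy–Schwarz for the form `R`: it is nonnegative at `(R⁻¹)ₚₚ u - uₚ R⁻¹ eₚ`.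
  have h := quadForm_nonneg hR.posSemidef (R⁻¹ p p • u + (-u p) • (R⁻¹ *ᵥ e))
  rw [quadForm_add hR.isHermitian] at h
  simp only [Matrix.mulVec_smul, hRe, smul_dotProduct, dotProduct_smul, smul_eq_mul, hee] at h
  rw [dotProduct_mulVec_comm hR.isHermitian (R⁻¹ *ᵥ e) u, hRe, hue] at h
  have h_mul : 0 ≤ R⁻¹ p p * (R⁻¹ p p * (u ⬝ᵥ (R *ᵥ u)) - u p ^ 2) := by linarith
  linarith [nonneg_of_mul_nonneg_right h_mul hpos]

section Riccati

variable {P A Q : Matrix k k ℝ} {B : Matrix k l ℝ} {R : Matrix l l ℝ}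

theorem gainWeight_mul_gainOp (hP : P.PosSemidef) (hR : R.PosDef) :
    gainWeight P B R * gainOp P A B R = Bᵀ * P * A := by
  have hdet : IsUnit (gainWeight P B R).det :=
    (Matrix.isUnit_iff_isUnit_det _).1 (gainWeight_posDef hP B hR).isUnit
  rw [gainOp, ← gainWeight, Matrix.mul_assoc, Matrix.mul_assoc,
    Matrix.mul_nonsing_inv_cancel_left _ _ hdet, Matrix.mul_assoc]

theorem riccatiOp_eq_sub_gainOp (hP : P.PosSemidef) (hR : R.PosDef) :
    riccatiOp P A B Q R
      = Q + Aᵀ * P * A - (gainOp P A B R)ᵀ * gainWeight P B R * gainOp P A B R := by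
  have hP' : Pᵀ = P := hP.isHermitian
  have hW : ((R + Bᵀ * P * B)⁻¹)ᵀ = (R + Bᵀ * P * B)⁻¹ :=
    (gainWeight_posDef hP B hR).inv.isHermitian
  rw [Matrix.mul_assoc (gainOp P A B R)ᵀ, gainWeight_mul_gainOp hP hR, gainOp, riccatiOp,
    Matrix.transpose_mul, Matrix.transpose_mul, Matrix.transpose_mul, hP', hW,
    Matrix.transpose_transpose]
  simp only [Matrix.mul_assoc]

theorem complete_square (hP : P.PosSemidef) (hR : R.PosDef) (x : k → ℝ) (u : l → ℝ) :
    x ⬝ᵥ (Q *ᵥ x) + u ⬝ᵥ (R *ᵥ u) + (A *ᵥ x + B *ᵥ u) ⬝ᵥ (P *ᵥ (A *ᵥ x + B *ᵥ u))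
      = x ⬝ᵥ (riccatiOp P A B Q R *ᵥ x)
        + (u + gainOp P A B R *ᵥ x) ⬝ᵥ (gainWeight P B R *ᵥ (u + gainOp P A B R *ᵥ x)) := by
  have hW := (gainWeight_posDef hP B hR).isHermitian
  have h_cross : (gainOp P A B R *ᵥ x) ⬝ᵥ (gainWeight P B R *ᵥ u)
      = (B *ᵥ u) ⬝ᵥ (P *ᵥ (A *ᵥ x)) := by
    rw [dotProduct_mulVec_comm hW, Matrix.mulVec_mulVec, gainWeight_mul_gainOp hP hR,
      mulVec_dotProduct_mulVec]
  rw [quadForm_add hP.isHermitian, quadForm_add hW, h_cross, riccatiOp_eq_sub_gainOp hP hR,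
    mulVec_dotProduct_mulVec P A A, mulVec_dotProduct_mulVec P B B,
    mulVec_dotProduct_mulVec (gainWeight P B R) (gainOp P A B R), gainWeight, Matrix.sub_mulVec,
    Matrix.add_mulVec Q, Matrix.add_mulVec R, dotProduct_sub, dotProduct_add, dotProduct_add]
  ring

theorem riccatiOp_posSemidef (A : Matrix k k ℝ) (B : Matrix k l ℝ) (hP : P.PosSemidef)
    (hQ : Q.PosSemidef) (hR : R.PosDef) : (riccatiOp P A B Q R).PosSemidef := by
  refine Matrix.PosSemidef.of_dotProduct_mulVec_nonneg ?_ fun x => ?_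
  · rw [riccatiOp_eq_sub_gainOp hP hR]
    exact (hQ.isHermitian.add (Matrix.isHermitian_conjTranspose_mul_mul A hP.isHermitian)).sub
      (Matrix.isHermitian_conjTranspose_mul_mul _ (gainWeight_posDef hP B hR).isHermitian)
  -- The value at `x` is the cost of the control `u = -L x`.
  · have h := complete_square (A := A) (Q := Q) (B := B) hP hR x (-(gainOp P A B R *ᵥ x))
    rw [neg_add_cancel, zero_dotProduct, add_zero] at h
    rw [star_trivial, ← h]
    exact add_nonneg (add_nonneg (quadForm_nonneg hQ x) (quadForm_nonneg hR.posSemidef _))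
      (quadForm_nonneg hP _)

variable {Ω : Type*} {m₀ : MeasurableSpace Ω} {μ : Measure Ω}

theorem expQuad_complete_square (hP : P.PosSemidef) (hR : R.PosDef) {x w : Ω → k → ℝ}
    {u : Ω → l → ℝ} (hx : MemLp x 2 μ) (hu : MemLp u 2 μ) (hw : MemLp w 2 μ)
    (h_orth : Orth μ (fun ω => A *ᵥ x ω + B *ᵥ u ω) w) :
    expQuad μ Q x + expQuad μ R u + expQuad μ P ((fun ω => A *ᵥ x ω + B *ᵥ u ω) + w)
      = expQuad μ (riccatiOp P A B Q R) x + expQuad μ P w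
        + expQuad μ (gainWeight P B R) (fun ω => u ω + gainOp P A B R *ᵥ x ω) := by
  have hy : MemLp (fun ω => A *ᵥ x ω + B *ᵥ u ω) 2 μ := (memLp_mulVec A hx).add (memLp_mulVec B hu)
  have hd : MemLp (fun ω => u ω + gainOp P A B R *ᵥ x ω) 2 μ := hu.add (memLp_mulVec _ hx)
  have h_square : expQuad μ Q x + expQuad μ R u + expQuad μ P (fun ω => A *ᵥ x ω + B *ᵥ u ω)
      = expQuad μ (riccatiOp P A B Q R) x
        + expQuad μ (gainWeight P B R) (fun ω => u ω + gainOp P A B R *ᵥ x ω) := by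
    have hQx := integrable_quadForm Q hx
    have hRu := integrable_quadForm R hu
    simp only [expQuad]
    rw [← integral_add' hQx hRu, ← integral_add' (hQx.add hRu) (integrable_quadForm P hy),
      ← integral_add' (integrable_quadForm _ hx) (integrable_quadForm _ hd)]
    exact integral_congr_ae (.of_forall fun ω => complete_square hP hR (x ω) (u ω))
  rw [expQuad_add_of_orth P hy hw h_orth]
  linarith

theorem lq_cost_eq {P : ℕ → Matrix k k ℝ} (hP : ∀ t, (P t).PosSemidef) (hR : R.PosDef) {N : ℕ}
    (hP_rec : ∀ t < N, P t = riccatiOp (P (t + 1)) A B Q R)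
    {x w : ℕ → Ω → k → ℝ} {u : ℕ → Ω → l → ℝ} (hx : ∀ t < N, MemLp (x t) 2 μ)
    (hu : ∀ t < N, MemLp (u t) 2 μ) (hw : ∀ t < N, MemLp (w t) 2 μ)
    (h_dyn : ∀ t < N, x (t + 1) =ᵐ[μ] (fun ω => A *ᵥ x t ω + B *ᵥ u t ω) + w t)
    (h_orth : ∀ t < N, Orth μ (fun ω => A *ᵥ x t ω + B *ᵥ u t ω) (w t)) :
    ∑ t ∈ Finset.range N, (expQuad μ Q (x t) + expQuad μ R (u t)) + expQuad μ (P N) (x N)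
      = expQuad μ (P 0) (x 0) + ∑ t ∈ Finset.range N, (expQuad μ (P (t + 1)) (w t)
        + expQuad μ (gainWeight (P (t + 1)) B R)
          (fun ω => u t ω + gainOp (P (t + 1)) A B R *ᵥ x t ω)) := by
  induction N with
  | zero => simp only [Finset.range_zero, Finset.sum_empty, zero_add, add_zero]
  | succ N ih =>
    have ih := ih (fun t ht => hP_rec t (by omega)) (fun t ht => hx t (by omega))
      (fun t ht => hu t (by omega)) (fun t ht => hw t (by omega)) (fun t ht => h_dyn t (by omega))
      fun t ht => h_orth t (by omega)
    have hN : N < N + 1 := N.lt_succ_self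
    have h_step := expQuad_complete_square (Q := Q) (hP (N + 1)) hR (hx N hN) (hu N hN) (hw N hN)
      (h_orth N hN)
    rw [← hP_rec N hN] at h_step
    rw [Finset.sum_range_succ, Finset.sum_range_succ, expQuad_congr_ae (h_dyn N hN)]
    linarith

end Riccati

end LinearQuadratic

section Gains

theorem riccatiToGo_posSemidef {k l : Type*} [Fintype k] [Fintype l] [DecidableEq l]
    (A : Matrix k k ℝ) (B : Matrix k l ℝ) {Q QT : Matrix k k ℝ} {R : Matrix l l ℝ}
    (hQ : Q.PosSemidef) (hQT : QT.PosSemidef) (hR : R.PosDef) :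
    ∀ j, (riccatiToGo A B Q QT R j).PosSemidef
  | 0 => hQT
  | j + 1 => riccatiOp_posSemidef A B (riccatiToGo_posSemidef A B hQ hQT hR j) hQ hR

variable {n : ℕ}

theorem diagBlk_posSemidef {d : Agent n → ℕ} {M : BlockMatrix d d} (hM : M.PosSemidef)
    (a : Agent n) : (diagBlk M a).PosSemidef :=
  hM.submatrix _

theorem diagBlk_posDef {d : Agent n → ℕ} {M : BlockMatrix d d} (hM : M.PosDef) (a : Agent n) :
    (diagBlk M a).PosDef :=
  hM.submatrix (sigma_mk_injective (β := fun b => Fin (d b)))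

variable (S : System n) (i : Fin n) {t : ℕ}

theorem System.Scom_posSemidef (t : ℕ) : (S.Scom t).PosSemidef :=
  riccatiToGo_posSemidef _ _ S.Q_psd S.QT_psd S.R_pd _

theorem System.Sloc_posSemidef (t : ℕ) : (S.Sloc i t).PosSemidef :=
  riccatiToGo_posSemidef _ _ (diagBlk_posSemidef S.Q_psd _) (diagBlk_posSemidef S.QT_psd _)
    (diagBlk_posDef S.R_pd _) _

theorem System.Scom_terminal : S.Scom S.N = S.QT := by
  rw [System.Scom, Nat.sub_self, riccatiToGo]

theorem System.Sloc_terminal : S.Sloc i S.N = diagBlk S.QT (some i) := by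
  rw [System.Sloc, Nat.sub_self, riccatiToGo]

theorem System.Scom_eq_riccatiOp (ht : t < S.N) :
    S.Scom t = riccatiOp (S.Scom (t + 1)) S.A S.B S.Q S.R := by
  rw [System.Scom, System.Scom, show S.N - t = S.N - (t + 1) + 1 by omega, riccatiToGo]

theorem System.Sloc_eq_riccatiOp (ht : t < S.N) :
    S.Sloc i t = riccatiOp (S.Sloc i (t + 1)) (diagBlk S.A (some i)) (diagBlk S.B (some i))
      (diagBlk S.Q (some i)) (diagBlk S.R (some i)) := by
  rw [System.Sloc, System.Sloc, show S.N - t = S.N - (t + 1) + 1 by omega, riccatiToGo]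

end Gains

/-! ### Block structure and linear recursions -/

section Blocks

variable {n : ℕ} {d e : Agent n → ℕ}

/-- Only the diagonal blocks and the blocks of the column of the major agent may be nonzero. -/
def MajorSparse (M : BlockMatrix d e) : Prop :=
  ∀ p q, q.1 ≠ p.1 → q.1 ≠ none → M p q = 0

theorem blk_mulVec_eq_diagBlk_mulVec {M : BlockMatrix d e} (hM : MajorSparse M) {x : Stacked e}
    {a : Agent n} (hx : a ≠ none → blk x none = 0) :
    blk (M *ᵥ x) a = diagBlk M a *ᵥ blk x a := by
  ext c
  simp only [blk, diagBlk, Matrix.mulVec, dotProduct, Matrix.submatrix_apply, Fintype.sum_sigma]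
  refine Finset.sum_eq_single a (fun b _ hb => Finset.sum_eq_zero fun c' _ => ?_) (by simp)
  rcases b with _ | i
  · rw [show x ⟨none, c'⟩ = 0 from congrFun (hx hb.symm) c', mul_zero]
  · rw [hM _ _ hb (Option.some_ne_none i), zero_mul]

variable {Ω : Type*}

/-- The stacked random vectors whose block of agent `a` has components in `𝒱 a`. -/
abbrev blockVec (d : Agent n → ℕ) (𝒱 : Agent n → Submodule ℝ (Ω → ℝ)) :
    Submodule ℝ (Ω → Stacked d) :=
  vec fun p => 𝒱 p.1

theorem MajorSparse.mulVec_mem_blockVec {M : BlockMatrix d e} (hM : MajorSparse M)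
    {𝒱 : Agent n → Submodule ℝ (Ω → ℝ)} (h_none : ∀ a, 𝒱 none ≤ 𝒱 a) {X : Ω → Stacked e}
    (hX : X ∈ blockVec e 𝒱) : (fun ω => M *ᵥ X ω) ∈ blockVec d 𝒱 := by
  refine mulVec_mem_vec (fun p q hpq => ?_) hX
  by_cases hq : q.1 = none
  · rw [hq]
    exact h_none p.1
  · rw [not_imp_comm.1 (hM p q · hq) hpq]

end Blocks

section Driven

variable {n : ℕ} {S : System n} {Ω : Type*} {u v : ℕ → Ω → Stacked S.du} {t : ℕ}

theorem driven_mem_blockVec {𝒱 : Agent n → Submodule ℝ (Ω → ℝ)} (h_none : ∀ a, 𝒱 none ≤ 𝒱 a)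
    (hu : ∀ s < t, u s ∈ blockVec S.du 𝒱) : driven S u t ∈ blockVec S.dx 𝒱 := by
  induction t with
  | zero => exact zero_mem _
  | succ t ih =>
    exact add_mem
      (MajorSparse.mulVec_mem_blockVec S.A_sparse h_none (ih fun s hs => hu s (by omega)))
      (MajorSparse.mulVec_mem_blockVec S.B_sparse h_none (hu t (by omega)))

theorem Primitives.xsto_mem_blockVec {ξ : Primitives S Ω} {𝒱 : Agent n → Submodule ℝ (Ω → ℝ)}
    (h_none : ∀ a, 𝒱 none ≤ 𝒱 a) (hx1 : ξ.x1vec ∈ blockVec S.dx 𝒱)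
    (hw : ∀ s < t, ξ.wvec s ∈ blockVec S.dx 𝒱) : ξ.xsto t ∈ blockVec S.dx 𝒱 := by
  induction t with
  | zero => exact hx1
  | succ t ih =>
    exact add_mem
      (MajorSparse.mulVec_mem_blockVec S.A_sparse h_none (ih fun s hs => hw s (by omega)))
      (hw t (by omega))

theorem driven_add (u v : ℕ → Ω → Stacked S.du) (t : ℕ) :
    driven S (u + v) t = driven S u t + driven S v t := by
  induction t with
  | zero => exact (add_zero _).symm
  | succ t ih =>
    ext1 ω
    simp only [driven, ih, Pi.add_apply, Matrix.mulVec_add]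
    abel

theorem driven_congr_ae [MeasurableSpace Ω] {μ : Measure Ω} (h : ∀ s < t, u s =ᵐ[μ] v s) :
    driven S u t =ᵐ[μ] driven S v t := by
  induction t with
  | zero => rfl
  | succ t ih =>
    filter_upwards [ih fun s hs => h s (by omega), h t (by omega)] with ω hx hu
    simp only [driven, hx, hu]

theorem Primitives.stateOf_eq_xsto_add_driven (ξ : Primitives S Ω) (u : ℕ → Ω → Stacked S.du)
    (t : ℕ) (ω : Ω) : ξ.stateOf (fun s => u s ω) ω t = ξ.xsto t ω + driven S u t ω := by
  induction t with
  | zero => exact (add_zero _).symm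
  | succ t ih =>
    simp only [Primitives.stateOf, Primitives.xsto, driven, ih, Matrix.mulVec_add]
    abel

end Driven

/-! ### The primitive random variables -/

section Primitives

variable {n : ℕ} {S : System n} {Ω : Type*}

/-- The primitive random variables with those of the minor agents replaced by `0`: its
`xsto` is the part of `x^s` that is common information. -/
def Primitives.majorPart (ξ : Primitives S Ω) : Primitives S Ω where
  x1 | none => ξ.x1 none
     | some _ => 0
  w | none => ξ.w none
    | some _ => 0
  v _ _ := 0

/-- The primitive random variables with those of the major agent replaced by `0`: its
`xsto` is the part of `x^s` that is independent of the common information. -/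
def Primitives.minorPart (ξ : Primitives S Ω) : Primitives S Ω where
  x1 | none => 0
     | some i => ξ.x1 (some i)
  w | none => 0
    | some i => ξ.w (some i)
  v := ξ.v

theorem Primitives.majorPart_xsto_add_minorPart_xsto (ξ : Primitives S Ω) (t : ℕ) :
    ξ.majorPart.xsto t + ξ.minorPart.xsto t = ξ.xsto t := by
  have h_x1 : ∀ ω, ξ.majorPart.x1vec ω + ξ.minorPart.x1vec ω = ξ.x1vec ω := fun ω => by
    ext ⟨_ | i, c⟩
    exacts [add_zero _, zero_add _]
  have h_w : ∀ t ω, ξ.majorPart.wvec t ω + ξ.minorPart.wvec t ω = ξ.wvec t ω := fun t ω => by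
    ext ⟨_ | i, c⟩
    exacts [add_zero _, zero_add _]
  induction t with
  | zero => exact funext h_x1
  | succ t ih =>
    ext1 ω
    simp only [Primitives.xsto, ← ih, ← h_w, Pi.add_apply, Matrix.mulVec_add]
    abel

/-- The sigma-algebra generated by the primitive random variables with labels in `K`. -/
@[reducible] def Primitives.sig (ξ : Primitives S Ω) (K : Set (PrimIdx n S.N)) :
    MeasurableSpace Ω :=
  ⨆ p ∈ K, MeasurableSpace.comap (ξ.fam p) inferInstance

theorem Primitives.sig_mono (ξ : Primitives S Ω) {K L : Set (PrimIdx n S.N)} (h : K ⊆ L) :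
    ξ.sig K ≤ ξ.sig L :=
  biSup_mono h

theorem Primitives.sig_union (ξ : Primitives S Ω) (K L : Set (PrimIdx n S.N)) :
    ξ.sig (K ∪ L) = ξ.sig K ⊔ ξ.sig L :=
  iSup_union

theorem Primitives.measurable_fam (ξ : Primitives S Ω) {K : Set (PrimIdx n S.N)}
    {p : PrimIdx n S.N} (hp : p ∈ K) : Measurable[ξ.sig K] (ξ.fam p) :=
  measurable_iff_comap_le.2 (le_biSup (fun p => MeasurableSpace.comap (ξ.fam p) inferInstance) hp)

/-- The labels of the primitive random variables that influence the information of agent `a` at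
time `t`. -/
def knownIdx (a : Agent n) (N t : ℕ) : Set (PrimIdx n N) :=
  {p | match p with
    | .init b => b = none ∨ b = a
    | .process b s => (b = none ∨ b = a) ∧ (s : ℕ) < t
    | .obs i s => a = some i ∧ (s : ℕ) ≤ t}

theorem knownIdx_mono (a : Agent n) (N : ℕ) : Monotone (knownIdx a N) := by
  rintro s t hst (b | ⟨b, r⟩ | ⟨i, r⟩) h
  exacts [h, ⟨h.1, h.2.trans_le hst⟩, ⟨h.1, h.2.trans hst⟩]

theorem knownIdx_none_subset (a : Agent n) (N t : ℕ) : knownIdx none N t ⊆ knownIdx a N t := by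
  rintro (b | ⟨b, r⟩ | ⟨i, r⟩) h
  exacts [.inl (or_self_iff.1 h), ⟨.inl (or_self_iff.1 h.1), h.2⟩, nomatch h.1]

theorem knownIdx_inter_subset {a b : Agent n} (hab : a ≠ b) (N t : ℕ) :
    knownIdx a N t ∩ knownIdx b N t ⊆ knownIdx none N t := by
  rintro (c | ⟨c, r⟩ | ⟨i, r⟩) ⟨ha, hb⟩
  · exact .inl (ha.elim id fun hca => hb.elim id fun hcb => absurd (hca.symm.trans hcb) hab)
  · exact ⟨.inl (ha.1.elim id fun hca =>
      hb.1.elim id fun hcb => absurd (hca.symm.trans hcb) hab), ha.2⟩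
  · exact absurd (ha.1.trans hb.1.symm) hab

theorem knownIdx_inter_none_subset (a : Agent n) (N s t : ℕ) :
    knownIdx a N s ∩ knownIdx none N t ⊆ knownIdx none N s := by
  rintro (c | ⟨c, r⟩ | ⟨i, r⟩) ⟨ha, h₀⟩
  exacts [h₀, ⟨h₀.1, ha.2⟩, nomatch h₀.1]

variable [MeasurableSpace Ω] {μ : Measure Ω} {ξ : Primitives S Ω}

theorem Primitives.Standard.sig_le (hξ : ξ.Standard μ) (K : Set (PrimIdx n S.N)) :
    ξ.sig K ≤ ‹MeasurableSpace Ω› :=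
  iSup₂_le fun p _ => (hξ.measurable p).comap_le

theorem Primitives.Standard.indep_sig (hξ : ξ.Standard μ) {K L : Set (PrimIdx n S.N)}
    (h : Disjoint K L) : Indep (ξ.sig K) (ξ.sig L) μ :=
  indep_iSup_of_disjoint (fun p => (hξ.measurable p).comap_le) hξ.indep h

variable [IsProbabilityMeasure μ]

theorem Primitives.Standard.condExp_sig (hξ : ξ.Standard μ) {K : Set (PrimIdx n S.N)}
    (L : Set (PrimIdx n S.N)) {X : Ω → ℝ} (hX : Measurable[ξ.sig K] X) :
    μ[X | ξ.sig L] =ᵐ[μ] μ[X | ξ.sig (K ∩ L)] := by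
  have h := condExp_sup_of_indep (hξ.sig_le K) (hξ.sig_le (L \ K))
    (ξ.sig_mono Set.inter_subset_left) (hξ.indep_sig Set.disjoint_sdiff_right)
    hX.stronglyMeasurable (m := ξ.sig (K ∩ L))
  rwa [← ξ.sig_union, Set.inter_comm K, Set.inter_union_sdiff, Set.inter_comm L] at h

theorem Primitives.Standard.centered_sig_of_inter_subset (hξ : ξ.Standard μ)
    {K L L' : Set (PrimIdx n S.N)} (h : K ∩ L' ⊆ L) :
    centered μ (ξ.sig K) (ξ.sig L) ≤ centered μ (ξ.sig K) (ξ.sig L') := by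
  rintro f ⟨hf, hf2, hf0⟩
  refine ⟨hf, hf2, (hξ.condExp_sig L' hf).trans ?_⟩
  calc μ[f | ξ.sig (K ∩ L')]
      =ᵐ[μ] μ[μ[f | ξ.sig L] | ξ.sig (K ∩ L')] :=
        (condExp_condExp_of_le (ξ.sig_mono h) (hξ.sig_le L)).symm
    _ =ᵐ[μ] μ[(0 : Ω → ℝ) | ξ.sig (K ∩ L')] := condExp_congr_ae hf0
    _ = 0 := condExp_zero

theorem Primitives.Standard.fam_mem_centered (hξ : ξ.Standard μ) (p : PrimIdx n S.N)
    (c : Fin (primDim S p)) {L : Set (PrimIdx n S.N)} (hp : p ∉ L) :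
    (fun ω => ξ.fam p ω c) ∈ centered μ (ξ.sig {p}) (ξ.sig L) := by
  have h_meas : Measurable[ξ.sig {p}] fun ω => ξ.fam p ω c :=
    (measurable_pi_apply c).comp (ξ.measurable_fam (Set.mem_singleton p))
  have h_disj : Disjoint {p} L := Set.disjoint_singleton_left.2 hp
  have h_mean : ∫ ω, ξ.fam p ω c ∂μ = 0 := by
    rw [← eval_integral fun q => ((hξ.memLp p).eval q).integrable one_le_two, hξ.mean_zero p,
      Pi.zero_apply]
  refine ⟨h_meas, (hξ.memLp p).eval c, ?_⟩
  have h := condExp_indep_eq (hξ.sig_le {p}) (hξ.sig_le L) h_meas.stronglyMeasurable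
    (hξ.indep_sig h_disj)
  rwa [h_mean] at h

/-- The square-integrable random variables that agent `a` can build from the primitive random
variables it may know at time `t`, with the part predictable from the common information
removed. -/
def Primitives.loc (ξ : Primitives S Ω) (μ : Measure Ω) [IsProbabilityMeasure μ] (t : ℕ)
    (a : Agent n) : Submodule ℝ (Ω → ℝ) :=
  centered μ (ξ.sig (knownIdx a S.N t)) (ξ.sig (knownIdx none S.N t))

theorem Primitives.Standard.loc_mono (hξ : ξ.Standard μ) {s t : ℕ} (hst : s ≤ t) (a : Agent n) :
    ξ.loc μ s a ≤ ξ.loc μ t a :=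
  (hξ.centered_sig_of_inter_subset (knownIdx_inter_none_subset a S.N s t)).trans
    (centered_mono (ξ.sig_mono (knownIdx_mono a S.N hst)) _)

theorem Primitives.loc_none_le (ξ : Primitives S Ω) (t : ℕ) (a : Agent n) :
    ξ.loc μ t none ≤ ξ.loc μ t a :=
  centered_mono (ξ.sig_mono (knownIdx_none_subset a S.N t)) _

theorem Primitives.Standard.integral_mul_loc_of_ne (hξ : ξ.Standard μ) {t : ℕ} {a b : Agent n}
    (hab : a ≠ b) {f g : Ω → ℝ} (hf : f ∈ ξ.loc μ t a) (hg : g ∈ ξ.loc μ t b) :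
    ∫ ω, f ω * g ω ∂μ = 0 :=
  integral_mul_eq_zero_of_mem_centered (hξ.sig_le _)
    (hξ.centered_sig_of_inter_subset (knownIdx_inter_subset hab S.N t) hf) hg.1 hg.2.1

theorem Primitives.Standard.ae_eq_zero_of_mem_loc_none (hξ : ξ.Standard μ) {t : ℕ} {f : Ω → ℝ}
    (hf : f ∈ ξ.loc μ t none) : f =ᵐ[μ] 0 :=
  ae_eq_zero_of_mem_centered_self (hξ.sig_le _) hf

theorem Primitives.Standard.minorPart_xsto_mem (hξ : ξ.Standard μ) {t : ℕ} (ht : t ≤ S.N) :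
    ξ.minorPart.xsto t ∈ blockVec S.dx (ξ.loc μ t) := by
  have h_fam : ∀ {i : Fin n} (p : PrimIdx n S.N) (c : Fin (primDim S p)),
      p ∈ knownIdx (some i) S.N t → p ∉ knownIdx none S.N t →
      (fun ω => ξ.fam p ω c) ∈ ξ.loc μ t (some i) := fun p c hp hp₀ =>
    centered_mono (ξ.sig_mono (Set.singleton_subset_iff.2 hp)) _ (hξ.fam_mem_centered p c hp₀)
  refine Primitives.xsto_mem_blockVec (ξ.loc_none_le t) ?_ fun s hs => ?_
  · rintro ⟨_ | i, c⟩
    · exact zero_mem _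
    · exact h_fam (.init (some i)) c (.inr rfl) (by simp [knownIdx])
  · rintro ⟨_ | i, c⟩
    · exact zero_mem _
    · exact h_fam (.process (some i) ⟨s, by omega⟩) c ⟨.inr rfl, hs⟩ (by simp [knownIdx])

end Primitives

/-! ### Information -/

section Information

variable {n : ℕ} {S : System n} {Ω : Type*} {ξ : Primitives S Ω} {u : ℕ → Ω → Stacked S.du}

theorem measurable_blk_driven {m : MeasurableSpace Ω} {a : Agent n} {t : ℕ}
    (h_none : ∀ s < t, Measurable[m] fun ω => blk (u s ω) none)
    (ha : ∀ s < t, Measurable[m] fun ω => blk (u s ω) a) :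
    Measurable[m] fun ω => blk (driven S u t ω) a := by
  classical
  let 𝒱 : Agent n → Submodule ℝ (Ω → ℝ) := fun b => if b = none ∨ b = a then measurableFun m else ⊤
  have h𝒱 : ∀ b, 𝒱 none ≤ 𝒱 b := fun b => by
    by_cases hb : b = none ∨ b = a <;> simp [𝒱, hb]
  have h_mem : driven S u t ∈ blockVec S.dx 𝒱 := by
    refine driven_mem_blockVec h𝒱 fun s hs => ?_
    rintro ⟨b, c⟩
    by_cases hb : b = none ∨ b = a
    · simp only [𝒱, hb, if_true]
      rcases hb with rfl | rfl
      exacts [(measurable_pi_apply c).comp (h_none s hs), (measurable_pi_apply c).comp (ha s hs)]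
    · simp only [𝒱, hb, if_false, Submodule.mem_top]
  refine measurable_pi_iff.2 fun c => ?_
  have hc := h_mem ⟨a, c⟩
  simp only [𝒱, or_true, if_true] at hc
  exact hc

/-- The output of minor agent `i` when no control is applied. -/
def Primitives.freeOutput (ξ : Primitives S Ω) (i : Fin n) (t : ℕ) (ω : Ω) : Fin (S.dy i) → ℝ :=
  S.C i *ᵥ blk (ξ.xsto t ω) (some i) + ξ.v i t ω

theorem Primitives.outputOf_eq_freeOutput_add (ξ : Primitives S Ω) (u : ℕ → Ω → Stacked S.du)
    (i : Fin n) (t : ℕ) (ω : Ω) : ξ.outputOf (fun s => u s ω) ω i t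
      = ξ.freeOutput i t ω + S.C i *ᵥ blk (driven S u t ω) (some i) := by
  have h_blk : blk (ξ.xsto t ω + driven S u t ω) (some i)
      = blk (ξ.xsto t ω) (some i) + blk (driven S u t ω) (some i) := rfl
  rw [Primitives.outputOf, ξ.stateOf_eq_xsto_add_driven, h_blk, Matrix.mulVec_add,
    Primitives.freeOutput]
  abel

/-- The information of agent `a` at time `t`, with the effect of the controls removed: `x^s_0` is
generated by the primitive random variables of the major agent, and minor agents observe their
output under zero control in addition. -/
@[reducible] def Primitives.sigInfo (ξ : Primitives S Ω) (t : ℕ) : Agent n → MeasurableSpace Ω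
  | none => ξ.sig (knownIdx none S.N t)
  | some i => ξ.sig (knownIdx none S.N t) ⊔
      ⨆ s : Fin (t + 1), MeasurableSpace.comap (ξ.freeOutput i s) inferInstance

theorem Primitives.sigInfo_none_le (ξ : Primitives S Ω) (t : ℕ) (a : Agent n) :
    ξ.sigInfo t none ≤ ξ.sigInfo t a := by
  rcases a with _ | i
  exacts [le_rfl, le_sup_left]

theorem Primitives.measurable_freeOutput (ξ : Primitives S Ω) (i : Fin n) {s t : ℕ} (hst : s ≤ t) :
    Measurable[ξ.sigInfo t (some i)] (ξ.freeOutput i s) :=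
  measurable_iff_comap_le.2 ((le_iSup (fun s : Fin (t + 1) => MeasurableSpace.comap
    (ξ.freeOutput i s) inferInstance) ⟨s, Nat.lt_succ_of_le hst⟩).trans le_sup_right)

theorem Primitives.sigInfo_mono (ξ : Primitives S Ω) {s t : ℕ} (hst : s ≤ t) (a : Agent n) :
    ξ.sigInfo s a ≤ ξ.sigInfo t a := by
  have h_none := ξ.sig_mono (knownIdx_mono none S.N hst)
  rcases a with _ | i
  · exact h_none
  · exact sup_le (h_none.trans le_sup_left) (iSup_le fun r =>
      (ξ.measurable_freeOutput i (by omega)).comap_le)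

theorem Primitives.measurable_blk_xsto (ξ : Primitives S Ω) {t : ℕ} (ht : t ≤ S.N) (a : Agent n) :
    Measurable[ξ.sig (knownIdx a S.N t)] fun ω => blk (ξ.xsto t ω) a := by
  have h_mem : ξ.xsto t ∈ blockVec S.dx fun a => measurableFun (ξ.sig (knownIdx a S.N t)) := by
    refine Primitives.xsto_mem_blockVec
      (fun a _ hf => hf.mono (ξ.sig_mono (knownIdx_none_subset a S.N t)) le_rfl) ?_ fun s hs => ?_
    · rintro ⟨a, c⟩
      have h_init : PrimIdx.init a ∈ knownIdx a S.N t := .inr rfl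
      exact (measurable_pi_apply c).comp (ξ.measurable_fam h_init)
    · rintro ⟨a, c⟩
      have h_process : PrimIdx.process a ⟨s, by omega⟩ ∈ knownIdx a S.N t := ⟨.inr rfl, hs⟩
      exact (measurable_pi_apply c).comp (ξ.measurable_fam h_process)
  exact mem_vec_measurableFun.1 fun c => h_mem ⟨a, c⟩

theorem Primitives.measurable_blk_none_xsto (ξ : Primitives S Ω) {s t : ℕ} (hst : s ≤ t)
    (ht : t ≤ S.N) (a : Agent n) :
    Measurable[ξ.sigInfo t a] fun ω => blk (ξ.xsto s ω) none :=
  (ξ.measurable_blk_xsto (hst.trans ht) none).mono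
    ((ξ.sig_mono (knownIdx_mono none S.N hst)).trans (ξ.sigInfo_none_le t a)) le_rfl

theorem Primitives.sigInfo_le_sig_knownIdx (ξ : Primitives S Ω) {t : ℕ} (ht : t ≤ S.N)
    (a : Agent n) : ξ.sigInfo t a ≤ ξ.sig (knownIdx a S.N t) := by
  rcases a with _ | i
  · exact le_rfl
  refine sup_le (ξ.sig_mono (knownIdx_none_subset _ _ _)) (iSup_le fun s => ?_)
  have hs : (s : ℕ) ≤ t := Nat.le_of_lt_succ s.2
  have h_obs : PrimIdx.obs i ⟨s, by omega⟩ ∈ knownIdx (some i) S.N t := ⟨rfl, hs⟩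
  have h_xsto : Measurable[ξ.sig (knownIdx (some i) S.N t)]
      fun ω => blk (ξ.xsto s ω) (some i) :=
    (ξ.measurable_blk_xsto (hs.trans ht) (some i)).mono (ξ.sig_mono (knownIdx_mono _ _ hs)) le_rfl
  have h_obs_meas : Measurable[ξ.sig (knownIdx (some i) S.N t)] (ξ.v i s) := ξ.measurable_fam h_obs
  exact ((measurable_mulVec (S.C i) h_xsto).add h_obs_meas).comap_le

/-- Every block of the controls is measurable for the control-free information of its agent, at
all times before `t`. -/
def AdaptedBefore (ξ : Primitives S Ω) (u : ℕ → Ω → Stacked S.du) (t : ℕ) : Prop :=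
  ∀ s < t, ∀ a, Measurable[ξ.sigInfo s a] fun ω => blk (u s ω) a

theorem AdaptedBefore.measurable_blk {t : ℕ} (hu : AdaptedBefore ξ u t) {s : ℕ} (hs : s < t)
    (a : Agent n) : Measurable[ξ.sigInfo t a] fun ω => blk (u s ω) a :=
  (hu s hs a).mono (ξ.sigInfo_mono hs.le a) le_rfl

theorem AdaptedBefore.measurable_blk_driven {s t : ℕ} (hu : AdaptedBefore ξ u t) (hst : s ≤ t)
    (a : Agent n) : Measurable[ξ.sigInfo t a] fun ω => blk (driven S u s ω) a :=
  MajorMinor.measurable_blk_driven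
    (fun _ hr => (hu.measurable_blk (hr.trans_le hst) none).mono (ξ.sigInfo_none_le t a) le_rfl)
    fun _ hr => hu.measurable_blk (hr.trans_le hst) a

theorem AdaptedBefore.measurable_infoMajorOf {t : ℕ} (hu : AdaptedBefore ξ u t) (ht : t ≤ S.N) :
    Measurable[ξ.sigInfo t none] fun ω => ξ.infoMajorOf (fun s => u s ω) ω t := by
  let _ := ξ.sigInfo t none
  refine .prodMk (measurable_pi_lambda _ fun s => ?_)
    (measurable_pi_lambda _ fun s => hu.measurable_blk s.2 none)
  have hs : (s : ℕ) ≤ t := Nat.le_of_lt_succ s.2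
  simp only [ξ.stateOf_eq_xsto_add_driven]
  exact (ξ.measurable_blk_none_xsto hs ht none).add (hu.measurable_blk_driven hs none)

theorem AdaptedBefore.measurable_infoMinorOf {t : ℕ} (hu : AdaptedBefore ξ u t) (ht : t ≤ S.N)
    (i : Fin n) :
    Measurable[ξ.sigInfo t (some i)] fun ω => ξ.infoMinorOf (fun s => u s ω) ω i t := by
  let _ := ξ.sigInfo t (some i)
  refine .prodMk ((hu.measurable_infoMajorOf ht).mono (ξ.sigInfo_none_le t _) le_rfl)
    (.prodMk (measurable_pi_lambda _ fun s => ?_)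
      (measurable_pi_lambda _ fun s => hu.measurable_blk s.2 (some i)))
  have hs : (s : ℕ) ≤ t := Nat.le_of_lt_succ s.2
  simp only [ξ.outputOf_eq_freeOutput_add]
  exact (ξ.measurable_freeOutput i hs).add
    (measurable_mulVec (S.C i) (hu.measurable_blk_driven hs (some i)))

theorem Primitives.sig_knownIdx_none_le {m : MeasurableSpace Ω} {t : ℕ}
    (h : ∀ s ≤ t, Measurable[m] fun ω => blk (ξ.xsto s ω) none) :
    ξ.sig (knownIdx none S.N t) ≤ m := by
  refine iSup₂_le ?_
  rintro (b | ⟨b, s⟩ | ⟨i, s⟩) hp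
  · obtain rfl : b = none := or_self_iff.1 hp
    exact (h 0 t.zero_le).comap_le
  · obtain ⟨hb, hs⟩ := hp
    obtain rfl : b = none := or_self_iff.1 hb
    have h_diff : ξ.w none s = fun ω =>
        blk (ξ.xsto (s + 1) ω) none - diagBlk S.A none *ᵥ blk (ξ.xsto s ω) none := by
      ext1 ω
      rw [← blk_mulVec_eq_diagBlk_mulVec S.A_sparse (absurd rfl), eq_sub_iff_add_eq']
      rfl
    refine Measurable.comap_le ?_
    change Measurable[m] (ξ.w none s)
    rw [h_diff]
    exact (h (s + 1) hs).sub (measurable_mulVec _ (h s hs.le))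
  · exact nomatch hp.1

theorem sigInfo_none_le_comap_infoMajorOf (ξ : Primitives S Ω) (u : ℕ → Ω → Stacked S.du) (t : ℕ) :
    ξ.sigInfo t none
      ≤ MeasurableSpace.comap (fun ω => ξ.infoMajorOf (fun s => u s ω) ω t) inferInstance := by
  set m := MeasurableSpace.comap (fun ω => ξ.infoMajorOf (fun s => u s ω) ω t) inferInstance
  have h_info : Measurable[m] fun ω => ξ.infoMajorOf (fun s => u s ω) ω t := comap_measurable _
  have hu : ∀ s < t, Measurable[m] fun ω => blk (u s ω) none := fun s hs =>
    (measurable_pi_apply (⟨s, hs⟩ : Fin t)).comp h_info.snd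
  refine Primitives.sig_knownIdx_none_le fun s hs => ?_
  have h_state : Measurable[m] fun ω => blk (ξ.xsto s ω + driven S u s ω) none := by
    simp only [← ξ.stateOf_eq_xsto_add_driven]
    exact (measurable_pi_apply (⟨s, by omega⟩ : Fin (t + 1))).comp h_info.fst
  have h_driven : Measurable[m] fun ω => blk (driven S u s ω) none :=
    measurable_blk_driven (fun r hr => hu r (by omega)) fun r hr => hu r (by omega)
  convert h_state.sub h_driven using 2 with ω
  exact (add_sub_cancel_right _ _).symm

theorem sigInfo_some_le_comap_infoMinorOf (ξ : Primitives S Ω) (u : ℕ → Ω → Stacked S.du)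
    (i : Fin n) (t : ℕ) : ξ.sigInfo t (some i)
      ≤ MeasurableSpace.comap (fun ω => ξ.infoMinorOf (fun s => u s ω) ω i t) inferInstance := by
  set m := MeasurableSpace.comap (fun ω => ξ.infoMinorOf (fun s => u s ω) ω i t) inferInstance
  have h_info : Measurable[m] fun ω => ξ.infoMinorOf (fun s => u s ω) ω i t := comap_measurable _
  have hu₀ : ∀ s < t, Measurable[m] fun ω => blk (u s ω) none := fun s hs =>
    (measurable_pi_apply (⟨s, hs⟩ : Fin t)).comp h_info.fst.snd
  have hu : ∀ s < t, Measurable[m] fun ω => blk (u s ω) (some i) := fun s hs =>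
    (measurable_pi_apply (⟨s, hs⟩ : Fin t)).comp h_info.snd.snd
  refine sup_le ((sigInfo_none_le_comap_infoMajorOf ξ u t).trans h_info.fst.comap_le)
    (iSup_le fun s => Measurable.comap_le ?_)
  have h_output : Measurable[m] fun ω => ξ.outputOf (fun r => u r ω) ω i s :=
    (measurable_pi_apply s).comp h_info.snd.fst
  have h_driven : Measurable[m] fun ω => blk (driven S u s ω) (some i) :=
    measurable_blk_driven (fun r hr => hu₀ r (by omega)) fun r hr => hu r (by omega)
  convert h_output.sub (measurable_mulVec (S.C i) h_driven) using 1
  ext1 ω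
  rw [Pi.sub_apply, ξ.outputOf_eq_freeOutput_add, add_sub_cancel_right]

end Information

/-! ### Closed-loop controls -/

section ClosedLoop

variable {n : ℕ} {S : System n} {Ω : Type*}

theorem Strategy.blk_control_none (g : Strategy S) (ξ : Primitives S Ω) (t : ℕ) (ω : Ω) :
    blk (g.control ξ t ω) none = g.major t (g.infoMajor ξ t ω) := by
  rw [g.control_eq]
  rfl

theorem Strategy.blk_control_some (g : Strategy S) (ξ : Primitives S Ω) (i : Fin n) (t : ℕ)
    (ω : Ω) : blk (g.control ξ t ω) (some i) = g.minor i t (g.infoMinor ξ i t ω) := by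
  rw [g.control_eq]
  rfl

theorem Strategy.adaptedBefore (g : Strategy S) (ξ : Primitives S Ω) {t : ℕ} (ht : t ≤ S.N + 1) :
    AdaptedBefore ξ (g.control ξ) t := by
  induction t with
  | zero => exact fun s hs => absurd hs s.not_lt_zero
  | succ t ih =>
    have ih := ih (by omega)
    intro s hs a
    obtain hst | rfl := Nat.lt_succ_iff_lt_or_eq.1 hs
    · exact ih s hst a
    have hs : s ≤ S.N := Nat.le_of_succ_le_succ ht
    rcases a with _ | i
    · simp only [g.blk_control_none]
      exact (g.measurable_major s).comp (ih.measurable_infoMajorOf hs)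
    · simp only [g.blk_control_some]
      exact (g.measurable_minor i s).comp (ih.measurable_infoMinorOf hs i)

theorem Strategy.measurable_blk_control (g : Strategy S) (ξ : Primitives S Ω) {t : ℕ}
    (ht : t ≤ S.N) (a : Agent n) : Measurable[ξ.sigInfo t a] fun ω => blk (g.control ξ t ω) a :=
  g.adaptedBefore ξ (Nat.succ_le_succ ht) t t.lt_succ_self a

theorem Strategy.sigmaCom_eq (g : Strategy S) (ξ : Primitives S Ω) {t : ℕ} (ht : t ≤ S.N) :
    g.sigmaCom ξ t = ξ.sigInfo t none :=
  le_antisymm ((g.adaptedBefore ξ ht.step).measurable_infoMajorOf ht).comap_le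
    (sigInfo_none_le_comap_infoMajorOf ξ (g.control ξ) t)

theorem Strategy.sigmaMinor_eq (g : Strategy S) (ξ : Primitives S Ω) (i : Fin n) {t : ℕ}
    (ht : t ≤ S.N) : g.sigmaMinor ξ i t = ξ.sigInfo t (some i) :=
  le_antisymm ((g.adaptedBefore ξ ht.step).measurable_infoMinorOf ht i).comap_le
    (sigInfo_some_le_comap_infoMinorOf ξ (g.control ξ) i t)

theorem AdaptedBefore.exists_strategy {ξ : Primitives S Ω} {u : ℕ → Ω → Stacked S.du}
    (hu : AdaptedBefore ξ u S.N) : ∃ g : Strategy S, ∀ t < S.N, g.control ξ t = u t := by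
  have h_major : ∀ t, ∃ h : InfoMajor S t → Fin (S.du none) → ℝ, Measurable h ∧
      (t < S.N → ∀ ω, blk (u t ω) none = h (ξ.infoMajorOf (fun s => u s ω) ω t)) := fun t => by
    by_cases ht : t < S.N
    · obtain ⟨h, h_meas, h_eq⟩ := ((hu t ht none).mono
        (sigInfo_none_le_comap_infoMajorOf ξ u t) le_rfl).exists_eq_measurable_comp
      exact ⟨h, h_meas, fun _ => congrFun h_eq⟩
    · exact ⟨0, measurable_const, fun h => absurd h ht⟩
  have h_minor : ∀ i t, ∃ h : InfoMinor S i t → Fin (S.du (some i)) → ℝ, Measurable h ∧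
      (t < S.N → ∀ ω, blk (u t ω) (some i) = h (ξ.infoMinorOf (fun s => u s ω) ω i t)) :=
    fun i t => by
      by_cases ht : t < S.N
      · obtain ⟨h, h_meas, h_eq⟩ := ((hu t ht (some i)).mono
          (sigInfo_some_le_comap_infoMinorOf ξ u i t) le_rfl).exists_eq_measurable_comp
        exact ⟨h, h_meas, fun _ => congrFun h_eq⟩
      · exact ⟨0, measurable_const, fun h => absurd h ht⟩
  choose major h_major h_major_eq using h_major
  choose minor h_minor h_minor_eq using h_minor
  let g : Strategy S := ⟨major, minor, h_major, h_minor⟩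
  refine ⟨g, fun t => ?_⟩
  induction t using Nat.strong_induction_on with
  | _ t ih =>
    intro ht
    ext1 ω
    rw [g.control_eq, g.act_congr ξ ω (us' := fun s => u s ω)
      fun s hs => congrFun (ih s hs (hs.trans ht)) ω]
    ext ⟨_ | i, c⟩
    exacts [(congrFun (h_major_eq t ht ω) c).symm, (congrFun (h_minor_eq i t ht ω) c).symm]

end ClosedLoop

/-! ### Common and local parts -/

section Split

variable {n : ℕ} {S : System n} {Ω : Type*} [MeasurableSpace Ω] {μ : Measure Ω}
  {ξ : Primitives S Ω}

theorem Primitives.Standard.sigInfo_le (hξ : ξ.Standard μ) {t : ℕ} (ht : t ≤ S.N) (a : Agent n) :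
    ξ.sigInfo t a ≤ ‹MeasurableSpace Ω› :=
  (ξ.sigInfo_le_sig_knownIdx ht a).trans (hξ.sig_le _)

/-- The square-integrable random variables that are common information at time `t`. -/
def Primitives.common (ξ : Primitives S Ω) (μ : Measure Ω) (t : ℕ) : Submodule ℝ (Ω → ℝ) :=
  measurableFun (ξ.sigInfo t none) ⊓ squareIntegrable μ

theorem Primitives.common_mono (ξ : Primitives S Ω) {s t : ℕ} (hst : s ≤ t) :
    ξ.common μ s ≤ ξ.common μ t :=
  inf_le_inf_right _ fun _ hf => hf.mono (ξ.sigInfo_mono hst none) le_rfl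

theorem Primitives.mem_vec_common {ι : Type*} [Fintype ι] {t : ℕ} {X : Ω → ι → ℝ} :
    X ∈ vec (fun _ => ξ.common μ t) ↔ Measurable[ξ.sigInfo t none] X ∧ MemLp X 2 μ :=
  mem_vec_inf.trans (and_congr mem_vec_measurableFun mem_vec_squareIntegrable)

theorem Primitives.Standard.majorPart_xsto_mem (hξ : ξ.Standard μ) {t : ℕ} (ht : t ≤ S.N) :
    ξ.majorPart.xsto t ∈ vec fun _ => ξ.common μ t := by
  have h_fam : ∀ (p : PrimIdx n S.N) (c : Fin (primDim S p)), p ∈ knownIdx none S.N t →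
      (fun ω => ξ.fam p ω c) ∈ ξ.common μ t := fun p c hp =>
    ⟨(measurable_pi_apply c).comp (ξ.measurable_fam hp), (hξ.memLp p).eval c⟩
  refine Primitives.xsto_mem_blockVec (𝒱 := fun _ => ξ.common μ t) (fun _ => le_rfl) ?_
    fun s hs => ?_
  · rintro ⟨_ | i, c⟩
    · exact h_fam (.init none) c (.inl rfl)
    · exact zero_mem _
  · rintro ⟨_ | i, c⟩
    · exact h_fam (.process none ⟨s, by omega⟩) c ⟨.inl rfl, hs⟩
    · exact zero_mem _

section Common

variable {g : Strategy S} {t : ℕ}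

theorem Strategy.ucom_mem (ht : t ≤ S.N) (hu : MemLp (g.control ξ t) 2 μ) :
    g.ucom ξ μ t ∈ vec fun _ => ξ.common μ t := by
  rw [Strategy.ucom, g.sigmaCom_eq ξ ht]
  exact Primitives.mem_vec_common.2
    ⟨stronglyMeasurable_condExp.measurable, hu.condExp one_le_two⟩

theorem Strategy.xcom_mem (ht : t ≤ S.N) (hu : ∀ s < t, MemLp (g.control ξ s) 2 μ) :
    g.xcom ξ μ t ∈ vec fun _ => ξ.common μ t :=
  driven_mem_blockVec (𝒱 := fun _ => ξ.common μ t) (fun _ => le_rfl) fun s hs =>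
    vec_mono (fun _ => ξ.common_mono hs.le) (Strategy.ucom_mem (hs.le.trans ht) (hu s hs))

end Common

variable [IsProbabilityMeasure μ]

/-- The square-integrable functions of the information of agent `a` at time `t` that are not
predictable from the common information. -/
def Primitives.infoLoc (ξ : Primitives S Ω) (μ : Measure Ω) [IsProbabilityMeasure μ] (t : ℕ)
    (a : Agent n) : Submodule ℝ (Ω → ℝ) :=
  centered μ (ξ.sigInfo t a) (ξ.sigInfo t none)

theorem Primitives.infoLoc_none_le (ξ : Primitives S Ω) (t : ℕ) (a : Agent n) :
    ξ.infoLoc μ t none ≤ ξ.infoLoc μ t a :=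
  centered_mono (ξ.sigInfo_none_le t a) _

theorem Primitives.infoLoc_le_loc (ξ : Primitives S Ω) {t : ℕ} (ht : t ≤ S.N) (a : Agent n) :
    ξ.infoLoc μ t a ≤ ξ.loc μ t a :=
  centered_mono (ξ.sigInfo_le_sig_knownIdx ht a) _

theorem Primitives.Standard.infoLoc_mono (hξ : ξ.Standard μ) {s t : ℕ} (hst : s ≤ t)
    (ht : t ≤ S.N) (a : Agent n) : ξ.infoLoc μ s a ≤ ξ.infoLoc μ t a := fun _ hf =>
  ⟨hf.1.mono (ξ.sigInfo_mono hst a) le_rfl,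
    (hξ.loc_mono hst a (ξ.infoLoc_le_loc (hst.trans ht) a hf)).2⟩

theorem Primitives.memLp_of_mem_blockVec_loc {d : Agent n → ℕ} {t : ℕ} {X : Ω → Stacked d}
    (hX : X ∈ blockVec d (ξ.loc μ t)) : MemLp X 2 μ :=
  mem_vec_squareIntegrable.1 fun p => (hX p).2.1

theorem Primitives.Standard.blk_none_ae_eq_zero (hξ : ξ.Standard μ) {d : Agent n → ℕ} {t : ℕ}
    {X : Ω → Stacked d} (hX : X ∈ blockVec d (ξ.loc μ t)) :
    (fun ω => blk (X ω) none) =ᵐ[μ] 0 := by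
  filter_upwards [ae_all_iff.2 fun c => hξ.ae_eq_zero_of_mem_loc_none (hX ⟨none, c⟩)] with ω h
    using funext h

/-- The estimate of the local part of `x^s_i(t)` by minor agent `i`. -/
def Primitives.ownHat (ξ : Primitives S Ω) (μ : Measure Ω) (i : Fin n) (t : ℕ) :
    Ω → Fin (S.dx (some i)) → ℝ :=
  μ[fun ω => blk (ξ.minorPart.xsto t ω) (some i) | ξ.sigInfo t (some i)]

theorem Primitives.Standard.ownHat_mem (hξ : ξ.Standard μ) (i : Fin n) {t : ℕ} (ht : t ≤ S.N) :
    ξ.ownHat μ i t ∈ vec fun _ => ξ.infoLoc μ t (some i) :=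
  condExp_mem_vec_centered (m := ξ.sig (knownIdx (some i) S.N t)) (hξ.sigInfo_le ht _)
    (ξ.sigInfo_none_le t _) fun c => hξ.minorPart_xsto_mem ht ⟨some i, c⟩

section Strategy

variable {g : Strategy S} {t : ℕ}

theorem Strategy.uloc_mem (hξ : ξ.Standard μ) (ht : t ≤ S.N) (hu : MemLp (g.control ξ t) 2 μ) :
    g.uloc ξ μ t ∈ blockVec S.du (ξ.infoLoc μ t) := by
  have h := sub_condExp_mem_vec_centered (m := fun p => ξ.sigInfo t p.1) (hξ.sigInfo_le ht none)
    (fun p => ξ.sigInfo_none_le t p.1)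
    (fun p => (measurable_pi_apply p.2).comp (g.measurable_blk_control ξ ht p.1)) hu
  have h_def : g.uloc ξ μ t = g.control ξ t - μ[g.control ξ t | ξ.sigInfo t none] := by
    rw [← g.sigmaCom_eq ξ ht]
    rfl
  rwa [h_def]

theorem Strategy.xloc_mem (hξ : ξ.Standard μ) (ht : t ≤ S.N)
    (hu : ∀ s < t, MemLp (g.control ξ s) 2 μ) :
    g.xloc ξ μ t ∈ blockVec S.dx (ξ.infoLoc μ t) := by
  refine driven_mem_blockVec (ξ.infoLoc_none_le t) fun s hs => ?_
  have h_uloc : g.uloc ξ μ s ∈ blockVec S.du (ξ.infoLoc μ s) :=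
    Strategy.uloc_mem hξ (hs.le.trans ht) (hu s hs)
  have h_mono : blockVec S.du (ξ.infoLoc μ s) ≤ blockVec S.du (ξ.infoLoc μ t) :=
    vec_mono fun p => hξ.infoLoc_mono hs.le ht p.1
  exact h_mono h_uloc

theorem Strategy.zhatCom_ae_eq (hξ : ξ.Standard μ) (ht : t ≤ S.N)
    (hu : ∀ s < t, MemLp (g.control ξ s) 2 μ) :
    g.zhatCom ξ μ t =ᵐ[μ] g.xcom ξ μ t + ξ.majorPart.xsto t := by
  obtain ⟨h_meas, h_memLp⟩ := Primitives.mem_vec_common.1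
    (add_mem (Strategy.xcom_mem ht hu) (hξ.majorPart_xsto_mem ht))
  have h_minor := hξ.minorPart_xsto_mem ht
  have h_split : g.zcom ξ μ t = (g.xcom ξ μ t + ξ.majorPart.xsto t) + ξ.minorPart.xsto t := by
    rw [add_assoc, ξ.majorPart_xsto_add_minorPart_xsto]
    rfl
  have h_minor_int : Integrable (ξ.minorPart.xsto t) μ :=
    (Primitives.memLp_of_mem_blockVec_loc h_minor).integrable one_le_two
  have h_zero : μ[ξ.minorPart.xsto t | ξ.sigInfo t none] =ᵐ[μ] 0 :=
    condExp_ae_eq_zero_of_mem_vec_centered h_minor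
  rw [Strategy.zhatCom, g.sigmaCom_eq ξ ht, h_split]
  filter_upwards [condExp_add_of_stronglyMeasurable_left (hξ.sigInfo_le ht none)
    h_meas.stronglyMeasurable (h_memLp.integrable one_le_two) h_minor_int, h_zero] with ω h h₀
  rw [h, Pi.add_apply, h₀, Pi.zero_apply, add_zero]

theorem Strategy.zhatLoc_ae_eq (hξ : ξ.Standard μ) (i : Fin n) (ht : t ≤ S.N)
    (hu : ∀ s < t, MemLp (g.control ξ s) 2 μ) :
    g.zhatLoc ξ μ i t
      =ᵐ[μ] (fun ω => blk (g.xloc ξ μ t ω) (some i)) + ξ.ownHat μ i t := by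
  set L := fun ω => blk (g.xloc ξ μ t ω) (some i)
  set K := fun ω => blk (ξ.majorPart.xsto t ω) (some i)
  set Y := fun ω => blk (ξ.minorPart.xsto t ω) (some i)
  have hL : L ∈ vec fun _ => ξ.infoLoc μ t (some i) := fun c =>
    Strategy.xloc_mem hξ ht hu ⟨some i, c⟩
  have hY : Y ∈ vec fun _ => ξ.loc μ t (some i) := fun c => hξ.minorPart_xsto_mem ht ⟨some i, c⟩
  obtain ⟨hK_meas, hK⟩ := Primitives.mem_vec_common.1
    (show K ∈ vec fun _ => ξ.common μ t from fun c => hξ.majorPart_xsto_mem ht ⟨some i, c⟩)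
  have hL_meas : Measurable[ξ.sigInfo t (some i)] L :=
    mem_vec_measurableFun.1 fun c => (hL c).1
  have hL_int : Integrable L μ :=
    (mem_vec_squareIntegrable.1 fun c => (hL c).2.1).integrable one_le_two
  have hY_int : Integrable Y μ :=
    (mem_vec_squareIntegrable.1 fun c => (hY c).2.1).integrable one_le_two
  have h_zloc : g.zloc ξ μ i t = K + (L + Y) := by
    ext1 ω
    rw [Strategy.zloc, ← ξ.majorPart_xsto_add_minorPart_xsto]
    exact add_left_comm _ _ _
  have h_zero : μ[L + Y | ξ.sigInfo t none] =ᵐ[μ] 0 := condExp_ae_eq_zero_of_mem_vec_centered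
    (add_mem (vec_mono (fun _ => ξ.infoLoc_le_loc ht _) hL) hY)
  rw [Strategy.zhatLoc, g.sigmaCom_eq ξ ht, g.sigmaMinor_eq ξ i ht, h_zloc]
  exact condExp_sub_condExp_ae_eq (hξ.sigInfo_le ht _) (ξ.sigInfo_none_le t _)
    hK_meas.stronglyMeasurable hL_meas.stronglyMeasurable (hK.integrable one_le_two) hL_int hY_int
    h_zero

end Strategy

end Split

/-! ### Decomposition of the cost -/

section CostSplit

variable {n : ℕ} {S : System n} {Ω : Type*} [MeasurableSpace Ω] {μ : Measure Ω}
  {ξ : Primitives S Ω}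

theorem Primitives.Standard.memLp_w (hξ : ξ.Standard μ) {t : ℕ} (ht : t < S.N) (a : Agent n) :
    MemLp (ξ.w a t) 2 μ :=
  hξ.memLp (.process a ⟨t, by omega⟩)

theorem Primitives.Standard.memLp_majorPart_wvec (hξ : ξ.Standard μ) {t : ℕ} (ht : t < S.N) :
    MemLp (ξ.majorPart.wvec t) 2 μ := by
  refine memLp_pi_iff.2 ?_
  rintro ⟨_ | i, c⟩
  exacts [(hξ.memLp_w ht none).eval c, MemLp.zero]

/-- The part `x^c + x^s_{0}` of the state: the response to `u^c` and to the noise of the major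
agent. -/
def Strategy.comState (g : Strategy S) (ξ : Primitives S Ω) (μ : Measure Ω) (t : ℕ) :
    Ω → Stacked S.dx :=
  g.xcom ξ μ t + ξ.majorPart.xsto t

/-- The remaining part of the state: the response to `u^ℓ` and to the noise of the minor agents. -/
def Strategy.locState (g : Strategy S) (ξ : Primitives S Ω) (μ : Measure Ω) (t : ℕ) :
    Ω → Stacked S.dx :=
  g.xloc ξ μ t + ξ.minorPart.xsto t

theorem Strategy.control_eq_ucom_add_uloc (g : Strategy S) (ξ : Primitives S Ω) (t : ℕ) :
    g.control ξ t = g.ucom ξ μ t + g.uloc ξ μ t :=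
  (add_sub_cancel _ _).symm

theorem Strategy.state_eq_comState_add_locState (g : Strategy S) (ξ : Primitives S Ω) (t : ℕ) :
    g.state ξ t = g.comState ξ μ t + g.locState ξ μ t := by
  have h_driven : driven S (g.control ξ) t = g.xcom ξ μ t + g.xloc ξ μ t := by
    rw [funext fun s => g.control_eq_ucom_add_uloc ξ s (μ := μ)]
    exact driven_add _ _ t
  have h_state : g.state ξ t = ξ.xsto t + driven S (g.control ξ) t :=
    funext (ξ.stateOf_eq_xsto_add_driven _ t)
  rw [h_state, h_driven, ← ξ.majorPart_xsto_add_minorPart_xsto, Strategy.comState,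
    Strategy.locState]
  abel

theorem Strategy.comState_mem {g : Strategy S} (hξ : ξ.Standard μ) {t : ℕ} (ht : t ≤ S.N)
    (hu : ∀ s < t, MemLp (g.control ξ s) 2 μ) :
    g.comState ξ μ t ∈ vec fun _ => ξ.common μ t :=
  add_mem (Strategy.xcom_mem ht hu) (hξ.majorPart_xsto_mem ht)

variable [IsProbabilityMeasure μ]

theorem Primitives.Standard.expQuad_loc (hξ : ξ.Standard μ) {d : Agent n → ℕ} {t : ℕ}
    (M : BlockMatrix d d) {X : Ω → Stacked d} (hX : X ∈ blockVec d (ξ.loc μ t)) :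
    expQuad μ M X = ∑ i, expQuad μ (diagBlk M (some i)) fun ω => blk (X ω) (some i) := by
  have hX2 := Primitives.memLp_of_mem_blockVec_loc hX
  have h_blk : ∀ a, MemLp (fun ω => blk (X ω) a) 2 μ := fun a =>
    memLp_pi_iff.2 fun c => hX2.eval ⟨a, c⟩
  have h_diag : expQuad μ M X = ∑ a, expQuad μ (diagBlk M a) fun ω => blk (X ω) a := by
    simp only [expQuad_eq_sum M hX2, expQuad_eq_sum _ (h_blk _), Fintype.sum_sigma]
    refine Finset.sum_congr rfl fun a _ => Finset.sum_congr rfl fun c _ => ?_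
    refine Finset.sum_eq_single a (fun b _ hba => Finset.sum_eq_zero fun c' _ => ?_)
      fun ha => absurd (Finset.mem_univ a) ha
    rw [hξ.integral_mul_loc_of_ne hba.symm (hX ⟨a, c⟩) (hX ⟨b, c'⟩), mul_zero]
  have h_none : expQuad μ (diagBlk M none) (fun ω => blk (X ω) none) = 0 := by
    rw [expQuad_congr_ae (hξ.blk_none_ae_eq_zero hX)]
    simp only [expQuad, Pi.zero_apply, zero_dotProduct, integral_zero]
  rw [h_diag, Fintype.sum_option, h_none, zero_add]

theorem Primitives.Standard.expQuad_common_add_loc (hξ : ξ.Standard μ) {d : Agent n → ℕ} {t : ℕ}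
    (M : BlockMatrix d d) {X Y : Ω → Stacked d} (hX : X ∈ vec fun _ => ξ.common μ t)
    (hY : Y ∈ blockVec d (ξ.loc μ t)) : expQuad μ M (X + Y)
      = expQuad μ M X + ∑ i, expQuad μ (diagBlk M (some i)) fun ω => blk (Y ω) (some i) := by
  have h_orth : Orth μ Y X := fun p q =>
    integral_mul_eq_zero_of_mem_centered (hξ.sig_le _) (hY p) (hX q).1 (hX q).2
  rw [expQuad_add_of_orth M (Primitives.mem_vec_common.1 hX).2
    (Primitives.memLp_of_mem_blockVec_loc hY) h_orth.symm, hξ.expQuad_loc M hY]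

theorem Primitives.Standard.orth_w (hξ : ξ.Standard μ) {t : ℕ} (ht : t < S.N) (a : Agent n)
    {κ : Type*} {X : Ω → κ → ℝ} (hX : X ∈ vec fun _ => measurableFun (ξ.sig (knownIdx a S.N t)))
    (hX2 : X ∈ vec fun _ => squareIntegrable μ) : Orth μ X (ξ.w a t) := by
  have h_notMem : PrimIdx.process a ⟨t, by omega⟩ ∉ knownIdx a S.N t := fun h =>
    lt_irrefl t h.2
  refine Orth.symm fun c p => integral_mul_eq_zero_of_mem_centered (hξ.sig_le _)
    (hξ.fam_mem_centered (.process a ⟨t, by omega⟩) c h_notMem) (hX p) (hX2 p)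

theorem Primitives.Standard.orth_majorPart_wvec (hξ : ξ.Standard μ) {t : ℕ} (ht : t < S.N)
    {κ : Type*} {X : Ω → κ → ℝ} (hX : X ∈ vec fun _ => ξ.common μ t) :
    Orth μ X (ξ.majorPart.wvec t) := by
  rintro p ⟨_ | i, c⟩
  · exact hξ.orth_w ht none (fun q => (hX q).1) (fun q => (hX q).2) p c
  · have h_zero : ∀ ω, ξ.majorPart.wvec t ω ⟨some i, c⟩ = 0 := fun _ => rfl
    simp only [h_zero, mul_zero, integral_zero]

/-- The deviation of `u^c(t)` from the optimal feedback. -/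
def Strategy.devCom (g : Strategy S) (ξ : Primitives S Ω) (μ : Measure Ω) (t : ℕ) (ω : Ω) :
    Stacked S.du :=
  g.ucom ξ μ t ω + S.Lcom t *ᵥ g.zhatCom ξ μ t ω

/-- The deviation of `u^ℓ_i(t)` from the optimal feedback. -/
def Strategy.devLoc (g : Strategy S) (ξ : Primitives S Ω) (μ : Measure Ω) (i : Fin n) (t : ℕ)
    (ω : Ω) : Fin (S.du (some i)) → ℝ :=
  blk (g.uloc ξ μ t ω) (some i) + S.Lloc i t *ᵥ g.zhatLoc ξ μ i t ω

/-- The error of the estimate `ownHat`. -/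
def Primitives.ownErr (ξ : Primitives S Ω) (μ : Measure Ω) (i : Fin n) (t : ℕ) :
    Ω → Fin (S.dx (some i)) → ℝ :=
  (fun ω => blk (ξ.minorPart.xsto t ω) (some i)) - ξ.ownHat μ i t

/-- The optimal cost of the centralized problem driven by the noise of the major agent only. -/
def Primitives.commonCost (ξ : Primitives S Ω) (μ : Measure Ω) : ℝ :=
  expQuad μ (S.Scom 0) (ξ.majorPart.xsto 0)
    + ∑ t ∈ Finset.range S.N, expQuad μ (S.Scom (t + 1)) (ξ.majorPart.wvec t)

/-- The quadratic weight of `devCom` in the cost. -/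
def System.Wcom (S : System n) (t : ℕ) : BlockMatrix S.du S.du :=
  gainWeight (S.Scom (t + 1)) S.B S.R

/-- The quadratic weight of `devLoc` in the cost. -/
def System.Wloc (S : System n) (i : Fin n) (t : ℕ) :
    Matrix (Fin (S.du (some i))) (Fin (S.du (some i))) ℝ :=
  gainWeight (S.Sloc i (t + 1)) (diagBlk S.B (some i)) (diagBlk S.R (some i))

/-- The optimal cost of the partially observed problem of minor agent `i` alone. -/
def Primitives.localCost (ξ : Primitives S Ω) (μ : Measure Ω) (i : Fin n) : ℝ :=
  expQuad μ (S.Sloc i 0) (fun ω => blk (ξ.minorPart.xsto 0 ω) (some i))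
    + ∑ t ∈ Finset.range S.N, (expQuad μ (S.Sloc i (t + 1)) (ξ.w (some i) t)
      + expQuad μ (S.Wloc i t) fun ω => S.Lloc i t *ᵥ ξ.ownErr μ i t ω)

variable {g : Strategy S} {t : ℕ}

theorem Strategy.locState_mem (hξ : ξ.Standard μ) (ht : t ≤ S.N)
    (hu : ∀ s < t, MemLp (g.control ξ s) 2 μ) :
    g.locState ξ μ t ∈ blockVec S.dx (ξ.loc μ t) := by
  have h_mono : blockVec S.dx (ξ.infoLoc μ t) ≤ blockVec S.dx (ξ.loc μ t) :=
    vec_mono fun p => ξ.infoLoc_le_loc ht p.1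
  exact add_mem (h_mono (Strategy.xloc_mem hξ ht hu)) (hξ.minorPart_xsto_mem ht)

theorem Strategy.uloc_mem_loc (hξ : ξ.Standard μ) (ht : t ≤ S.N)
    (hu : MemLp (g.control ξ t) 2 μ) : g.uloc ξ μ t ∈ blockVec S.du (ξ.loc μ t) := by
  have h_mono : blockVec S.du (ξ.infoLoc μ t) ≤ blockVec S.du (ξ.loc μ t) :=
    vec_mono fun p => ξ.infoLoc_le_loc ht p.1
  exact h_mono (Strategy.uloc_mem hξ ht hu)

theorem Strategy.expQuad_state (hξ : ξ.Standard μ) (ht : t ≤ S.N)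
    (hu : ∀ s < t, MemLp (g.control ξ s) 2 μ) (M : BlockMatrix S.dx S.dx) :
    expQuad μ M (g.state ξ t) = expQuad μ M (g.comState ξ μ t)
      + ∑ i, expQuad μ (diagBlk M (some i)) fun ω => blk (g.locState ξ μ t ω) (some i) := by
  rw [g.state_eq_comState_add_locState ξ t (μ := μ), hξ.expQuad_common_add_loc M
    (Strategy.comState_mem hξ ht hu) (Strategy.locState_mem hξ ht hu)]

theorem Strategy.expQuad_control (hξ : ξ.Standard μ) (ht : t ≤ S.N)
    (hu : MemLp (g.control ξ t) 2 μ) (M : BlockMatrix S.du S.du) :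
    expQuad μ M (g.control ξ t) = expQuad μ M (g.ucom ξ μ t)
      + ∑ i, expQuad μ (diagBlk M (some i)) fun ω => blk (g.uloc ξ μ t ω) (some i) := by
  rw [g.control_eq_ucom_add_uloc ξ t (μ := μ), hξ.expQuad_common_add_loc M
    (Strategy.ucom_mem ht hu) (Strategy.uloc_mem_loc hξ ht hu)]

theorem Strategy.common_cost_eq (hξ : ξ.Standard μ)
    (hu : ∀ t < S.N, MemLp (g.control ξ t) 2 μ) :
    ∑ t ∈ Finset.range S.N, (expQuad μ S.Q (g.comState ξ μ t) + expQuad μ S.R (g.ucom ξ μ t))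
        + expQuad μ S.QT (g.comState ξ μ S.N)
      = ξ.commonCost μ + ∑ t ∈ Finset.range S.N, expQuad μ (S.Wcom t) (g.devCom ξ μ t) := by
  have hx : ∀ t < S.N, g.comState ξ μ t ∈ vec fun _ => ξ.common μ t := fun t ht =>
    Strategy.comState_mem hξ ht.le fun s hs => hu s (hs.trans ht)
  have hucom : ∀ t < S.N, g.ucom ξ μ t ∈ vec fun _ => ξ.common μ t := fun t ht =>
    Strategy.ucom_mem ht.le (hu t ht)
  have h_dyn : ∀ t, g.comState ξ μ (t + 1)
      = (fun ω => S.A *ᵥ g.comState ξ μ t ω + S.B *ᵥ g.ucom ξ μ t ω) + ξ.majorPart.wvec t :=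
    fun t => by
      ext1 ω
      simp only [Strategy.comState, Strategy.xcom, driven, Primitives.xsto, Pi.add_apply,
        Matrix.mulVec_add]
      abel
  have h_orth : ∀ t < S.N, Orth μ (fun ω => S.A *ᵥ g.comState ξ μ t ω + S.B *ᵥ g.ucom ξ μ t ω)
      (ξ.majorPart.wvec t) := fun t ht => hξ.orth_majorPart_wvec ht (add_mem
    (mulVec_mem_vec (fun _ _ _ => le_rfl) (hx t ht))
    (mulVec_mem_vec (fun _ _ _ => le_rfl) (hucom t ht)))
  have h_dev : ∀ t < S.N,
      (fun ω => g.ucom ξ μ t ω + S.Lcom t *ᵥ g.comState ξ μ t ω) =ᵐ[μ] g.devCom ξ μ t :=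
    fun t ht => by
      filter_upwards [Strategy.zhatCom_ae_eq hξ ht.le fun s hs => hu s (hs.trans ht)] with ω h
      rw [Strategy.devCom, h, Strategy.comState]
  have h_init : g.comState ξ μ 0 = ξ.majorPart.xsto 0 := zero_add _
  rw [← S.Scom_terminal, lq_cost_eq S.Scom_posSemidef S.R_pd (fun t ht => S.Scom_eq_riccatiOp ht)
    (fun t ht => (Primitives.mem_vec_common.1 (hx t ht)).2)
    (fun t ht => (Primitives.mem_vec_common.1 (hucom t ht)).2)
    (fun t ht => hξ.memLp_majorPart_wvec ht) (fun t _ => .of_eq (h_dyn t)) h_orth,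
    Finset.sum_add_distrib, ← add_assoc, h_init, Primitives.commonCost]
  exact congrArg _ (Finset.sum_congr rfl fun t ht =>
    expQuad_congr_ae (h_dev t (Finset.mem_range.1 ht)))

theorem Strategy.blk_locState_succ_ae_eq (hξ : ξ.Standard μ) (i : Fin n) (ht : t < S.N)
    (hu : ∀ s < S.N, MemLp (g.control ξ s) 2 μ) :
    (fun ω => blk (g.locState ξ μ (t + 1) ω) (some i))
      =ᵐ[μ] (fun ω => diagBlk S.A (some i) *ᵥ blk (g.locState ξ μ t ω) (some i)
        + diagBlk S.B (some i) *ᵥ blk (g.uloc ξ μ t ω) (some i)) + ξ.w (some i) t := by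
  have hx := Strategy.locState_mem hξ ht.le fun s hs => hu s (hs.trans ht)
  filter_upwards [hξ.blk_none_ae_eq_zero hx,
    hξ.blk_none_ae_eq_zero (Strategy.uloc_mem_loc hξ ht.le (hu t ht))] with ω hx₀ hu₀
  have h_dyn : g.locState ξ μ (t + 1) ω
      = S.A *ᵥ g.locState ξ μ t ω + S.B *ᵥ g.uloc ξ μ t ω + ξ.minorPart.wvec t ω := by
    simp only [Strategy.locState, Strategy.xloc, driven, Primitives.xsto, Pi.add_apply,
      Matrix.mulVec_add]
    abel
  rw [h_dyn, Pi.add_apply, ← blk_mulVec_eq_diagBlk_mulVec S.A_sparse fun _ => hx₀,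
    ← blk_mulVec_eq_diagBlk_mulVec S.B_sparse fun _ => hu₀]
  rfl

theorem Primitives.Standard.ownErr_mem (hξ : ξ.Standard μ) (i : Fin n) (ht : t ≤ S.N) :
    ξ.ownErr μ i t ∈ vec fun _ =>
      centered μ (ξ.sig (knownIdx (some i) S.N t)) (ξ.sigInfo t (some i)) := by
  have hY : (fun ω => blk (ξ.minorPart.xsto t ω) (some i)) ∈ vec fun _ => ξ.loc μ t (some i) :=
    fun c => hξ.minorPart_xsto_mem ht ⟨some i, c⟩
  exact sub_condExp_mem_vec_centered (hξ.sigInfo_le ht (some i))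
    (fun _ => ξ.sigInfo_le_sig_knownIdx ht _) (fun c => (hY c).1)
    (mem_vec_squareIntegrable.1 fun c => (hY c).2.1)

theorem Strategy.expQuad_uloc_add_Lloc_locState (hξ : ξ.Standard μ) (i : Fin n) (ht : t < S.N)
    (hu : ∀ s < S.N, MemLp (g.control ξ s) 2 μ)
    (M : Matrix (Fin (S.du (some i))) (Fin (S.du (some i))) ℝ) :
    expQuad μ M (fun ω => blk (g.uloc ξ μ t ω) (some i)
        + S.Lloc i t *ᵥ blk (g.locState ξ μ t ω) (some i))
      = expQuad μ M (g.devLoc ξ μ i t)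
        + expQuad μ M fun ω => S.Lloc i t *ᵥ ξ.ownErr μ i t ω := by
  have hu_lt : ∀ s < t, MemLp (g.control ξ s) 2 μ := fun s hs => hu s (hs.trans ht)
  let Z : Ω → Fin (S.dx (some i)) → ℝ :=
    (fun ω => blk (g.xloc ξ μ t ω) (some i)) + ξ.ownHat μ i t
  let D : Ω → Fin (S.du (some i)) → ℝ :=
    fun ω => blk (g.uloc ξ μ t ω) (some i) + S.Lloc i t *ᵥ Z ω
  have hZ : Z ∈ vec fun _ => ξ.infoLoc μ t (some i) :=
    add_mem (fun c => Strategy.xloc_mem hξ ht.le hu_lt ⟨some i, c⟩) (hξ.ownHat_mem i ht.le)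
  have hD : D ∈ vec fun _ => ξ.infoLoc μ t (some i) :=
    add_mem (fun c => Strategy.uloc_mem hξ ht.le (hu t ht) ⟨some i, c⟩)
      (mulVec_mem_vec (fun _ _ _ => le_rfl) hZ)
  have hD_dev : D =ᵐ[μ] g.devLoc ξ μ i t := by
    filter_upwards [Strategy.zhatLoc_ae_eq hξ i ht.le hu_lt] with ω h
    rw [Strategy.devLoc, h]
  let E : Ω → Fin (S.du (some i)) → ℝ := fun ω => S.Lloc i t *ᵥ ξ.ownErr μ i t ω
  have hE := mulVec_mem_vec (M := S.Lloc i t) (fun _ _ _ => le_rfl) (hξ.ownErr_mem i ht.le)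
  have h_orth : Orth μ D E := Orth.symm fun c p => integral_mul_eq_zero_of_mem_centered
    (hξ.sigInfo_le ht.le _) (hE c) (hD p).1 (hD p).2.1
  have h_split : (fun ω => blk (g.uloc ξ μ t ω) (some i)
      + S.Lloc i t *ᵥ blk (g.locState ξ μ t ω) (some i)) = D + E := by
    ext1 ω
    have h_blk : blk (g.locState ξ μ t ω) (some i) = Z ω + ξ.ownErr μ i t ω := by
      simp only [Z, Strategy.locState, Primitives.ownErr, Pi.add_apply, Pi.sub_apply]
      rw [add_assoc, add_sub_cancel]
      rfl
    rw [h_blk, Matrix.mulVec_add, ← add_assoc, Pi.add_apply]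
  rw [h_split, expQuad_add_of_orth M (mem_vec_squareIntegrable.1 fun c => (hD c).2.1)
    (mem_vec_squareIntegrable.1 fun c => (hE c).2.1) h_orth, expQuad_congr_ae hD_dev]

theorem Strategy.local_cost_eq (hξ : ξ.Standard μ) (hu : ∀ t < S.N, MemLp (g.control ξ t) 2 μ)
    (i : Fin n) :
    ∑ t ∈ Finset.range S.N,
        (expQuad μ (diagBlk S.Q (some i)) (fun ω => blk (g.locState ξ μ t ω) (some i))
          + expQuad μ (diagBlk S.R (some i)) fun ω => blk (g.uloc ξ μ t ω) (some i))
        + expQuad μ (diagBlk S.QT (some i)) (fun ω => blk (g.locState ξ μ S.N ω) (some i))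
      = ξ.localCost μ i + ∑ t ∈ Finset.range S.N, expQuad μ (S.Wloc i t) (g.devLoc ξ μ i t) := by
  have hx : ∀ t < S.N, (fun ω => blk (g.locState ξ μ t ω) (some i))
      ∈ vec fun _ => ξ.loc μ t (some i) := fun t ht c =>
    Strategy.locState_mem hξ ht.le (fun s hs => hu s (hs.trans ht)) ⟨some i, c⟩
  have huloc : ∀ t < S.N, (fun ω => blk (g.uloc ξ μ t ω) (some i))
      ∈ vec fun _ => ξ.loc μ t (some i) := fun t ht c =>
    Strategy.uloc_mem_loc hξ ht.le (hu t ht) ⟨some i, c⟩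
  have h_orth : ∀ t < S.N, Orth μ (fun ω =>
      diagBlk S.A (some i) *ᵥ blk (g.locState ξ μ t ω) (some i)
        + diagBlk S.B (some i) *ᵥ blk (g.uloc ξ μ t ω) (some i)) (ξ.w (some i) t) :=
    fun t ht => by
      have h := add_mem
        (mulVec_mem_vec (M := diagBlk S.A (some i)) (fun _ _ _ => le_rfl) (hx t ht))
        (mulVec_mem_vec (M := diagBlk S.B (some i)) (fun _ _ _ => le_rfl) (huloc t ht))
      exact hξ.orth_w ht (some i) (fun c => (h c).1) fun c => (h c).2.1
  have h_init : g.locState ξ μ 0 = ξ.minorPart.xsto 0 := zero_add _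
  rw [← S.Sloc_terminal, lq_cost_eq (S.Sloc_posSemidef i) (diagBlk_posDef S.R_pd _)
    (fun t ht => S.Sloc_eq_riccatiOp i ht)
    (fun t ht => mem_vec_squareIntegrable.1 fun c => (hx t ht c).2.1)
    (fun t ht => mem_vec_squareIntegrable.1 fun c => (huloc t ht c).2.1)
    (fun t ht => hξ.memLp_w ht _) (fun t ht => Strategy.blk_locState_succ_ae_eq hξ i ht hu) h_orth,
    h_init, Primitives.localCost, add_assoc, ← Finset.sum_add_distrib]
  refine congrArg _ (Finset.sum_congr rfl fun t ht => ?_)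
  rw [add_assoc, add_comm (expQuad μ (S.Wloc i t) _)]
  exact congrArg _ (Strategy.expQuad_uloc_add_Lloc_locState hξ i (Finset.mem_range.1 ht) hu _)

/-- The optimal cost. -/
def Primitives.minCost (ξ : Primitives S Ω) (μ : Measure Ω) : ℝ :=
  ξ.commonCost μ + ∑ i, ξ.localCost μ i

/-- The excess of the cost over `minCost`, see `Strategy.integral_pathCost`. -/
def Strategy.excessCost (g : Strategy S) (ξ : Primitives S Ω) (μ : Measure Ω) : ℝ :=
  ∑ t ∈ Finset.range S.N, expQuad μ (S.Wcom t) (g.devCom ξ μ t)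
    + ∑ i, ∑ t ∈ Finset.range S.N, expQuad μ (S.Wloc i t) (g.devLoc ξ μ i t)

theorem Strategy.memLp_state (hξ : ξ.Standard μ) (ht : t ≤ S.N)
    (hu : ∀ s < t, MemLp (g.control ξ s) 2 μ) : MemLp (g.state ξ t) 2 μ := by
  rw [g.state_eq_comState_add_locState ξ t (μ := μ)]
  exact (Primitives.mem_vec_common.1 (Strategy.comState_mem hξ ht hu)).2.add
    (Primitives.memLp_of_mem_blockVec_loc (Strategy.locState_mem hξ ht hu))

theorem Strategy.integrable_stageCost (hξ : ξ.Standard μ)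
    (hu : ∀ t < S.N, MemLp (g.control ξ t) 2 μ) (ht : t < S.N) :
    Integrable (fun ω => g.state ξ t ω ⬝ᵥ (S.Q *ᵥ g.state ξ t ω)
      + g.control ξ t ω ⬝ᵥ (S.R *ᵥ g.control ξ t ω)) μ :=
  (integrable_quadForm _ (Strategy.memLp_state hξ ht.le fun s hs => hu s (hs.trans ht))).add
    (integrable_quadForm _ (hu t ht))

theorem Strategy.integrable_pathCost (hξ : ξ.Standard μ)
    (hu : ∀ t < S.N, MemLp (g.control ξ t) 2 μ) : Integrable (g.pathCost ξ) μ :=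
  (integrable_finsetSum _ fun _ ht =>
    Strategy.integrable_stageCost hξ hu (Finset.mem_range.1 ht)).add
      (integrable_quadForm _ (Strategy.memLp_state hξ le_rfl hu))

theorem Strategy.integral_pathCost_eq_sum (hξ : ξ.Standard μ)
    (hu : ∀ t < S.N, MemLp (g.control ξ t) 2 μ) :
    ∫ ω, g.pathCost ξ ω ∂μ = ∑ t ∈ Finset.range S.N,
        (expQuad μ S.Q (g.state ξ t) + expQuad μ S.R (g.control ξ t))
      + expQuad μ S.QT (g.state ξ S.N) := by
  have h_stage : ∀ t ∈ Finset.range S.N, Integrable (fun ω =>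
      g.state ξ t ω ⬝ᵥ (S.Q *ᵥ g.state ξ t ω)
        + g.control ξ t ω ⬝ᵥ (S.R *ᵥ g.control ξ t ω)) μ := fun t ht =>
    Strategy.integrable_stageCost hξ hu (Finset.mem_range.1 ht)
  simp only [Strategy.pathCost]
  rw [integral_add (integrable_finsetSum _ h_stage)
    (integrable_quadForm _ (Strategy.memLp_state hξ le_rfl hu)), integral_finsetSum _ h_stage]
  refine congrArg (· + _) (Finset.sum_congr rfl fun t ht => ?_)
  have ht := Finset.mem_range.1 ht
  exact integral_add
    (integrable_quadForm _ (Strategy.memLp_state hξ ht.le fun s hs => hu s (hs.trans ht)))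
    (integrable_quadForm _ (hu t ht))

theorem Strategy.integral_pathCost (hξ : ξ.Standard μ)
    (hu : ∀ t < S.N, MemLp (g.control ξ t) 2 μ) :
    ∫ ω, g.pathCost ξ ω ∂μ = ξ.minCost μ + g.excessCost ξ μ := by
  have h_stage : ∀ t ∈ Finset.range S.N,
      expQuad μ S.Q (g.state ξ t) + expQuad μ S.R (g.control ξ t)
        = (expQuad μ S.Q (g.comState ξ μ t) + expQuad μ S.R (g.ucom ξ μ t))
          + ∑ i, (expQuad μ (diagBlk S.Q (some i)) (fun ω => blk (g.locState ξ μ t ω) (some i))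
            + expQuad μ (diagBlk S.R (some i)) fun ω => blk (g.uloc ξ μ t ω) (some i)) :=
    fun t ht => by
      have ht := Finset.mem_range.1 ht
      rw [Strategy.expQuad_state hξ ht.le fun s hs => hu s (hs.trans ht),
        Strategy.expQuad_control hξ ht.le (hu t ht), add_add_add_comm, Finset.sum_add_distrib]
  rw [Strategy.integral_pathCost_eq_sum hξ hu, Finset.sum_congr rfl h_stage,
    Strategy.expQuad_state hξ le_rfl hu, Finset.sum_add_distrib, Finset.sum_comm, add_add_add_comm,
    Strategy.common_cost_eq hξ hu, ← Finset.sum_add_distrib,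
    Finset.sum_congr rfl fun i _ => Strategy.local_cost_eq hξ hu i, Finset.sum_add_distrib,
    add_add_add_comm]
  rfl

end CostSplit

/-! ### The optimal feedback -/

section Feedback

variable {n : ℕ} {S : System n} {Ω : Type*}

/-- The state of the closed loop `x(t+1) = A x(t) + B F_t(x(t))` with zero initial state, for
random feedback laws `F_t`. -/
def loopState (S : System n) (F : ℕ → Stacked S.dx → Ω → Stacked S.du) : ℕ → Ω → Stacked S.dx
  | 0 => fun _ => 0
  | t + 1 => fun ω => S.A *ᵥ loopState S F t ω + S.B *ᵥ F t (loopState S F t ω) ω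

/-- The control of the closed loop with the random feedback laws `F_t`. -/
def loopControl (S : System n) (F : ℕ → Stacked S.dx → Ω → Stacked S.du) (t : ℕ) (ω : Ω) :
    Stacked S.du :=
  F t (loopState S F t ω) ω

theorem driven_loopControl (F : ℕ → Stacked S.dx → Ω → Stacked S.du) (t : ℕ) :
    driven S (loopControl S F) t = loopState S F t := by
  induction t with
  | zero => rfl
  | succ t ih => simp only [driven, loopState, loopControl, ih]

theorem loopControl_eq (F : ℕ → Stacked S.dx → Ω → Stacked S.du) (t : ℕ) (ω : Ω) :
    loopControl S F t ω = F t (driven S (loopControl S F) t ω) ω := by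
  rw [driven_loopControl, loopControl]

theorem forall_ae_eq_loopControl_iff [MeasurableSpace Ω] {μ : Measure Ω}
    {F : ℕ → Stacked S.dx → Ω → Stacked S.du} {u : ℕ → Ω → Stacked S.du} {N : ℕ} :
    (∀ t < N, u t =ᵐ[μ] loopControl S F t)
      ↔ ∀ t < N, u t =ᵐ[μ] fun ω => F t (driven S u t ω) ω := by
  constructor
  · intro h t ht
    filter_upwards [h t ht, driven_congr_ae fun s hs => h s (hs.trans ht)] with ω hu hx
    rw [hu, hx, loopControl_eq]
  · intro h t
    induction t using Nat.strong_induction_on with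
    | _ t ih =>
      intro ht
      filter_upwards [h t ht, driven_congr_ae fun s hs => ih s hs (hs.trans ht)] with ω hu hx
      rw [hu, hx, loopControl_eq]

/-- The optimal feedback law for `u^c(t)`. -/
def Primitives.comLaw (ξ : Primitives S Ω) (t : ℕ) (x : Stacked S.dx) (ω : Ω) : Stacked S.du :=
  -(S.Lcom t *ᵥ (x + ξ.majorPart.xsto t ω))

/-- The optimal `u^c(t)`. -/
def Primitives.optCom (ξ : Primitives S Ω) : ℕ → Ω → Stacked S.du :=
  loopControl S ξ.comLaw

variable [MeasurableSpace Ω] {μ : Measure Ω} {ξ : Primitives S Ω} {t : ℕ}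

/-- The optimal feedback law for `u^ℓ(t)`. -/
def Primitives.locLaw (ξ : Primitives S Ω) (μ : Measure Ω) (t : ℕ) (x : Stacked S.dx) (ω : Ω) :
    Stacked S.du
  | ⟨none, _⟩ => 0
  | ⟨some i, c⟩ => -(S.Lloc i t *ᵥ (blk x (some i) + ξ.ownHat μ i t ω)) c

/-- The optimal `u^ℓ(t)`. -/
def Primitives.optLoc (ξ : Primitives S Ω) (μ : Measure Ω) : ℕ → Ω → Stacked S.du :=
  loopControl S (ξ.locLaw μ)

theorem Primitives.Standard.optCom_mem (hξ : ξ.Standard μ) (ht : t ≤ S.N) :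
    ξ.optCom t ∈ vec fun _ => ξ.common μ t := by
  induction t using Nat.strong_induction_on with
  | _ t ih =>
    have h_driven : driven S ξ.optCom t ∈ vec fun _ => ξ.common μ t :=
      driven_mem_blockVec (𝒱 := fun _ => ξ.common μ t) (fun _ => le_rfl) fun s hs =>
        vec_mono (fun _ => ξ.common_mono hs.le) (ih s hs (hs.le.trans ht))
    rw [show ξ.optCom t = -fun ω => S.Lcom t *ᵥ (driven S ξ.optCom t + ξ.majorPart.xsto t) ω from
      funext (loopControl_eq _ t)]
    exact neg_mem (mulVec_mem_vec (fun _ _ _ => le_rfl)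
      (add_mem h_driven (hξ.majorPart_xsto_mem ht)))

variable [IsProbabilityMeasure μ]

theorem Primitives.Standard.optLoc_mem (hξ : ξ.Standard μ) (ht : t ≤ S.N) :
    ξ.optLoc μ t ∈ blockVec S.du (ξ.infoLoc μ t) := by
  induction t using Nat.strong_induction_on with
  | _ t ih =>
    have h_driven : driven S (ξ.optLoc μ) t ∈ blockVec S.dx (ξ.infoLoc μ t) := by
      refine driven_mem_blockVec (ξ.infoLoc_none_le t) fun s hs => ?_
      have h_mono : blockVec S.du (ξ.infoLoc μ s) ≤ blockVec S.du (ξ.infoLoc μ t) :=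
        vec_mono fun p => hξ.infoLoc_mono hs.le ht p.1
      exact h_mono (ih s hs (hs.le.trans ht))
    rw [show ξ.optLoc μ t = fun ω => ξ.locLaw μ t (driven S (ξ.optLoc μ) t ω) ω from
      funext (loopControl_eq _ t)]
    rintro ⟨_ | i, c⟩
    · exact zero_mem _
    · have h_blk : (fun ω => blk (driven S (ξ.optLoc μ) t ω) (some i))
          ∈ vec fun _ => ξ.infoLoc μ t (some i) := fun c => h_driven ⟨some i, c⟩
      have h_gain := mulVec_mem_vec (M := S.Lloc i t) (fun _ _ _ => le_rfl)
        (add_mem h_blk (hξ.ownHat_mem i ht))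
      exact neg_mem (h_gain c)

theorem Primitives.Standard.memLp_optCom_add_optLoc (hξ : ξ.Standard μ) (ht : t ≤ S.N) :
    MemLp (ξ.optCom t + ξ.optLoc μ t) 2 μ :=
  (Primitives.mem_vec_common.1 (hξ.optCom_mem ht)).2.add
    (mem_vec_squareIntegrable.1 fun p => (hξ.optLoc_mem ht p).2.1)

theorem Primitives.Standard.exists_strategy_control_eq_opt (hξ : ξ.Standard μ) :
    ∃ g : Strategy S, ∀ t < S.N, g.control ξ t = ξ.optCom t + ξ.optLoc μ t := by
  refine AdaptedBefore.exists_strategy (u := fun t => ξ.optCom t + ξ.optLoc μ t)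
    fun t ht a => mem_vec_measurableFun.1 fun c => ?_
  have h_com : Measurable[ξ.sigInfo t a] fun ω => ξ.optCom t ω ⟨a, c⟩ :=
    (hξ.optCom_mem ht.le ⟨a, c⟩).1.mono (ξ.sigInfo_none_le t a) le_rfl
  exact (measurableFun (ξ.sigInfo t a)).add_mem h_com (hξ.optLoc_mem ht.le ⟨a, c⟩).1

variable {g : Strategy S}

theorem Strategy.ucom_ae_eq_optCom (hξ : ξ.Standard μ) (ht : t ≤ S.N)
    (h : g.control ξ t =ᵐ[μ] ξ.optCom t + ξ.optLoc μ t) : g.ucom ξ μ t =ᵐ[μ] ξ.optCom t := by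
  obtain ⟨h_meas, h_memLp⟩ := Primitives.mem_vec_common.1 (hξ.optCom_mem ht)
  have h_loc : MemLp (ξ.optLoc μ t) 2 μ :=
    mem_vec_squareIntegrable.1 fun p => (hξ.optLoc_mem ht p).2.1
  have h_zero : μ[ξ.optLoc μ t | ξ.sigInfo t none] =ᵐ[μ] 0 :=
    condExp_ae_eq_zero_of_mem_vec_centered (hξ.optLoc_mem ht)
  rw [Strategy.ucom, g.sigmaCom_eq ξ ht]
  filter_upwards [condExp_congr_ae (m := ξ.sigInfo t none) h,
    condExp_add_of_stronglyMeasurable_left (hξ.sigInfo_le ht none) h_meas.stronglyMeasurable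
      (h_memLp.integrable one_le_two) (h_loc.integrable one_le_two), h_zero] with ω h₁ h₂ h₃
  rw [h₁, h₂, Pi.add_apply, h₃, Pi.zero_apply, add_zero]

theorem Strategy.control_ae_eq_opt_iff (hξ : ξ.Standard μ) (ht : t ≤ S.N) :
    g.control ξ t =ᵐ[μ] ξ.optCom t + ξ.optLoc μ t
      ↔ g.ucom ξ μ t =ᵐ[μ] ξ.optCom t ∧ g.uloc ξ μ t =ᵐ[μ] ξ.optLoc μ t := by
  constructor
  · intro h
    have h_ucom := Strategy.ucom_ae_eq_optCom hξ ht h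
    refine ⟨h_ucom, ?_⟩
    filter_upwards [h, h_ucom] with ω h h_ucom
    rw [Strategy.uloc, h, h_ucom, Pi.add_apply, add_sub_cancel_left]
  · rintro ⟨h_ucom, h_uloc⟩
    rw [g.control_eq_ucom_add_uloc ξ t (μ := μ)]
    exact h_ucom.add h_uloc

end Feedback

/-! ### Optimality -/

section Optimality

variable {n : ℕ} {S : System n} {Ω : Type*} {t : ℕ}

theorem Strategy.stageCost_nonneg (g : Strategy S) (ξ : Primitives S Ω) (t : ℕ) (ω : Ω) :
    0 ≤ g.state ξ t ω ⬝ᵥ (S.Q *ᵥ g.state ξ t ω)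
      + g.control ξ t ω ⬝ᵥ (S.R *ᵥ g.control ξ t ω) :=
  add_nonneg (quadForm_nonneg S.Q_psd _) (quadForm_nonneg S.R_pd.posSemidef _)

theorem Strategy.pathCost_nonneg (g : Strategy S) (ξ : Primitives S Ω) (ω : Ω) :
    0 ≤ g.pathCost ξ ω :=
  add_nonneg (Finset.sum_nonneg fun t _ => g.stageCost_nonneg ξ t ω)
    (quadForm_nonneg S.QT_psd _)

theorem Strategy.control_quadForm_le_pathCost (g : Strategy S) (ξ : Primitives S Ω)
    (ht : t < S.N) (ω : Ω) :
    g.control ξ t ω ⬝ᵥ (S.R *ᵥ g.control ξ t ω) ≤ g.pathCost ξ ω :=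
  calc g.control ξ t ω ⬝ᵥ (S.R *ᵥ g.control ξ t ω)
      ≤ g.state ξ t ω ⬝ᵥ (S.Q *ᵥ g.state ξ t ω)
          + g.control ξ t ω ⬝ᵥ (S.R *ᵥ g.control ξ t ω) :=
        le_add_of_nonneg_left (quadForm_nonneg S.Q_psd _)
    _ ≤ _ := Finset.single_le_sum (fun t _ => g.stageCost_nonneg ξ t ω) (Finset.mem_range.2 ht)
    _ ≤ g.pathCost ξ ω := le_add_of_nonneg_right (quadForm_nonneg S.QT_psd _)

variable [MeasurableSpace Ω] {μ : Measure Ω} {ξ : Primitives S Ω} {g : Strategy S}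

/-- The controls of `g` are integrable and follow the optimal feedback. -/
def Strategy.IsFeedback (g : Strategy S) (ξ : Primitives S Ω) (μ : Measure Ω) : Prop :=
  ∀ t < S.N, Integrable (g.control ξ t) μ ∧ g.devCom ξ μ t =ᵐ[μ] 0 ∧
    ∀ i, g.devLoc ξ μ i t =ᵐ[μ] 0

theorem Strategy.memLp_control_of_J_ne_top (hξ : ξ.Standard μ) (hJ : g.J ξ μ ≠ ⊤) (ht : t < S.N) :
    MemLp (g.control ξ t) 2 μ := by
  refine memLp_pi_iff.2 fun p => ?_
  have h_meas : Measurable fun ω => g.control ξ t ω p :=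
    ((measurable_pi_apply p.2).comp (g.measurable_blk_control ξ ht.le p.1)).mono
      (hξ.sigInfo_le ht.le p.1) le_rfl
  have h_inv : 0 ≤ S.R⁻¹ p p := S.R_pd.inv.diag_pos.le
  have h_le : ∀ ω, g.control ξ t ω p ^ 2 ≤ S.R⁻¹ p p * g.pathCost ξ ω := fun ω =>
    (sq_apply_le_quadForm S.R_pd p _).trans
      (mul_le_mul_of_nonneg_left (g.control_quadForm_le_pathCost ξ ht ω) h_inv)
  refine (memLp_two_iff_integrable_sq h_meas.aestronglyMeasurable).2
    ⟨(h_meas.pow_const 2).aestronglyMeasurable, ?_⟩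
  rw [hasFiniteIntegral_iff_ofReal (.of_forall fun ω => sq_nonneg _)]
  calc ∫⁻ ω, ENNReal.ofReal (g.control ξ t ω p ^ 2) ∂μ
      ≤ ∫⁻ ω, ENNReal.ofReal (S.R⁻¹ p p) * ENNReal.ofReal (g.pathCost ξ ω) ∂μ :=
        lintegral_mono fun ω => by
          rw [← ENNReal.ofReal_mul h_inv]
          exact ENNReal.ofReal_le_ofReal (h_le ω)
    _ = ENNReal.ofReal (S.R⁻¹ p p) * g.J ξ μ := lintegral_const_mul' _ _ ENNReal.ofReal_ne_top
    _ < ⊤ := ENNReal.mul_lt_top ENNReal.ofReal_lt_top hJ.lt_top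

theorem System.Wcom_posDef (S : System n) (t : ℕ) : (S.Wcom t).PosDef :=
  gainWeight_posDef (S.Scom_posSemidef _) _ S.R_pd

theorem System.Wloc_posDef (S : System n) (i : Fin n) (t : ℕ) : (S.Wloc i t).PosDef :=
  gainWeight_posDef (S.Sloc_posSemidef i _) _ (diagBlk_posDef S.R_pd _)

theorem Strategy.excessCost_nonneg (g : Strategy S) (ξ : Primitives S Ω) (μ : Measure Ω) :
    0 ≤ g.excessCost ξ μ :=
  add_nonneg
    (Finset.sum_nonneg fun t _ => expQuad_nonneg (S.Wcom_posDef t).posSemidef _)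
    (Finset.sum_nonneg fun i _ => Finset.sum_nonneg fun t _ =>
      expQuad_nonneg (S.Wloc_posDef i t).posSemidef _)

variable [IsProbabilityMeasure μ]

theorem Strategy.J_eq_ofReal (hξ : ξ.Standard μ) (hu : ∀ t < S.N, MemLp (g.control ξ t) 2 μ) :
    g.J ξ μ = ENNReal.ofReal (ξ.minCost μ + g.excessCost ξ μ) := by
  rw [← Strategy.integral_pathCost hξ hu, ofReal_integral_eq_lintegral_ofReal
    (Strategy.integrable_pathCost hξ hu) (.of_forall (g.pathCost_nonneg ξ)), Strategy.J]

theorem Strategy.memLp_zhatCom (hξ : ξ.Standard μ) (ht : t ≤ S.N)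
    (hu : ∀ s < t, MemLp (g.control ξ s) 2 μ) : MemLp (g.zhatCom ξ μ t) 2 μ :=
  (Primitives.mem_vec_common.1 (Strategy.comState_mem hξ ht hu)).2.ae_eq
    (Strategy.zhatCom_ae_eq hξ ht hu).symm

theorem Strategy.memLp_zhatLoc (hξ : ξ.Standard μ) (i : Fin n) (ht : t ≤ S.N)
    (hu : ∀ s < t, MemLp (g.control ξ s) 2 μ) : MemLp (g.zhatLoc ξ μ i t) 2 μ := by
  have h_mem : (fun ω => blk (g.xloc ξ μ t ω) (some i)) + ξ.ownHat μ i t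
      ∈ vec fun _ => ξ.infoLoc μ t (some i) :=
    add_mem (fun c => Strategy.xloc_mem hξ ht hu ⟨some i, c⟩) (hξ.ownHat_mem i ht)
  exact (mem_vec_squareIntegrable.1 fun c => (h_mem c).2.1).ae_eq
    (Strategy.zhatLoc_ae_eq hξ i ht hu).symm

theorem Strategy.memLp_devCom (hξ : ξ.Standard μ) (ht : t < S.N)
    (hu : ∀ s < S.N, MemLp (g.control ξ s) 2 μ) : MemLp (g.devCom ξ μ t) 2 μ :=
  ((hu t ht).condExp one_le_two).add
    (memLp_mulVec _ (Strategy.memLp_zhatCom hξ ht.le fun s hs => hu s (hs.trans ht)))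

theorem Strategy.memLp_devLoc (hξ : ξ.Standard μ) (i : Fin n) (ht : t < S.N)
    (hu : ∀ s < S.N, MemLp (g.control ξ s) 2 μ) : MemLp (g.devLoc ξ μ i t) 2 μ :=
  (memLp_pi_iff.2 fun c => (Strategy.uloc_mem hξ ht.le (hu t ht) ⟨some i, c⟩).2.1).add
    (memLp_mulVec _ (Strategy.memLp_zhatLoc hξ i ht.le fun s hs => hu s (hs.trans ht)))

theorem Strategy.isFeedback_iff_excessCost_eq_zero (hξ : ξ.Standard μ)
    (hu : ∀ t < S.N, MemLp (g.control ξ t) 2 μ) :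
    g.IsFeedback ξ μ ↔ g.excessCost ξ μ = 0 := by
  have h_com : ∀ t ∈ Finset.range S.N, 0 ≤ expQuad μ (S.Wcom t) (g.devCom ξ μ t) := fun t _ =>
    expQuad_nonneg (S.Wcom_posDef t).posSemidef _
  have h_loc : ∀ i, ∀ t ∈ Finset.range S.N, 0 ≤ expQuad μ (S.Wloc i t) (g.devLoc ξ μ i t) :=
    fun i t _ => expQuad_nonneg (S.Wloc_posDef i t).posSemidef _
  rw [Strategy.excessCost, add_eq_zero_iff_of_nonneg (Finset.sum_nonneg h_com)
    (Finset.sum_nonneg fun i _ => Finset.sum_nonneg (h_loc i)), Finset.sum_eq_zero_iff_of_nonneg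
    h_com, Finset.sum_eq_zero_iff_of_nonneg fun i _ => Finset.sum_nonneg (h_loc i)]
  simp only [Finset.sum_eq_zero_iff_of_nonneg (h_loc _), Finset.mem_range, Finset.mem_univ,
    forall_const]
  constructor
  · exact fun h => ⟨fun t ht =>
      (expQuad_eq_zero_iff (S.Wcom_posDef t) (Strategy.memLp_devCom hξ ht hu)).2 (h t ht).2.1,
      fun i t ht => (expQuad_eq_zero_iff (S.Wloc_posDef i t)
        (Strategy.memLp_devLoc hξ i ht hu)).2 ((h t ht).2.2 i)⟩
  · exact fun ⟨h₁, h₂⟩ t ht => ⟨(hu t ht).integrable one_le_two,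
      (expQuad_eq_zero_iff (S.Wcom_posDef t) (Strategy.memLp_devCom hξ ht hu)).1 (h₁ t ht),
      fun i => (expQuad_eq_zero_iff (S.Wloc_posDef i t)
        (Strategy.memLp_devLoc hξ i ht hu)).1 (h₂ i t ht)⟩

theorem Strategy.blk_uloc_none_ae_eq_zero (hξ : ξ.Standard μ) (ht : t ≤ S.N)
    (h_int : Integrable (g.control ξ t) μ) : (fun ω => blk (g.uloc ξ μ t ω) none) =ᵐ[μ] 0 := by
  have h_apply : ∀ c, ∀ᵐ ω ∂μ, g.ucom ξ μ t ω ⟨none, c⟩ = g.control ξ t ω ⟨none, c⟩ := fun c => by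
    have h_meas : StronglyMeasurable[ξ.sigInfo t none] fun ω => g.control ξ t ω ⟨none, c⟩ :=
      ((measurable_pi_apply c).comp (g.measurable_blk_control ξ ht none)).stronglyMeasurable
    have h := condExp_apply (m := ξ.sigInfo t none) h_int ⟨none, c⟩
    rwa [condExp_of_stronglyMeasurable (hξ.sigInfo_le ht none) h_meas (h_int.eval _),
      ← g.sigmaCom_eq ξ ht] at h
  filter_upwards [ae_all_iff.2 h_apply] with ω h
  exact funext fun c => sub_eq_zero.2 (h c).symm

theorem Strategy.IsFeedback.memLp_control (hξ : ξ.Standard μ) (hg : g.IsFeedback ξ μ)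
    (ht : t < S.N) : MemLp (g.control ξ t) 2 μ := by
  induction t using Nat.strong_induction_on with
  | _ t ih =>
    have hu : ∀ s < t, MemLp (g.control ξ s) 2 μ := fun s hs => ih s hs (hs.trans ht)
    obtain ⟨h_int, h_com, h_loc⟩ := hg t ht
    have h_ucom : MemLp (g.ucom ξ μ t) 2 μ :=
      (memLp_mulVec (S.Lcom t) (Strategy.memLp_zhatCom hξ ht.le hu)).neg.ae_eq
        (h_com.mono fun ω h => (eq_neg_of_add_eq_zero_left h).symm)
    have h_uloc : ∀ a, MemLp (fun ω => blk (g.uloc ξ μ t ω) a) 2 μ := by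
      rintro (_ | i)
      · exact MemLp.zero.ae_eq (Strategy.blk_uloc_none_ae_eq_zero hξ ht.le h_int).symm
      · exact (memLp_mulVec (S.Lloc i t) (Strategy.memLp_zhatLoc hξ i ht.le hu)).neg.ae_eq
          ((h_loc i).mono fun ω h => (eq_neg_of_add_eq_zero_left h).symm)
    rw [g.control_eq_ucom_add_uloc ξ t (μ := μ)]
    exact h_ucom.add (memLp_pi_iff.2 fun p => (h_uloc p.1).eval p.2)

theorem Strategy.devCom_ae_eq_zero_iff (hξ : ξ.Standard μ) (ht : t ≤ S.N)
    (hu : ∀ s < t, MemLp (g.control ξ s) 2 μ) : g.devCom ξ μ t =ᵐ[μ] 0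
      ↔ g.ucom ξ μ t =ᵐ[μ] fun ω => ξ.comLaw t (g.xcom ξ μ t ω) ω := by
  refine Filter.eventually_congr ?_
  filter_upwards [Strategy.zhatCom_ae_eq hξ ht hu] with ω h
  rw [Strategy.devCom, h, Pi.zero_apply, Primitives.comLaw, eq_neg_iff_add_eq_zero, Pi.add_apply]

theorem Strategy.devLoc_ae_eq_zero_iff (hξ : ξ.Standard μ) (ht : t ≤ S.N)
    (hu : ∀ s < t, MemLp (g.control ξ s) 2 μ) (h_int : Integrable (g.control ξ t) μ) :
    (∀ i, g.devLoc ξ μ i t =ᵐ[μ] 0)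
      ↔ g.uloc ξ μ t =ᵐ[μ] fun ω => ξ.locLaw μ t (g.xloc ξ μ t ω) ω := by
  simp only [Filter.EventuallyEq]
  rw [← ae_all_iff]
  refine Filter.eventually_congr ?_
  filter_upwards [ae_all_iff.2 fun i => Strategy.zhatLoc_ae_eq hξ i ht hu,
    Strategy.blk_uloc_none_ae_eq_zero hξ ht h_int] with ω h h₀
  simp only [Strategy.devLoc, h, Pi.zero_apply, ← eq_neg_iff_add_eq_zero, Pi.add_apply]
  constructor
  · intro h_blk
    ext ⟨_ | i, c⟩
    exacts [congrFun h₀ c, congrFun (h_blk i) c]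
  · exact fun h_eq i => funext fun c => congrFun h_eq ⟨some i, c⟩

theorem Strategy.isFeedback_iff_control_ae_eq (hξ : ξ.Standard μ) : g.IsFeedback ξ μ
    ↔ ∀ t < S.N, g.control ξ t =ᵐ[μ] ξ.optCom t + ξ.optLoc μ t := by
  have h_iff : (∀ t < S.N, MemLp (g.control ξ t) 2 μ) → (g.IsFeedback ξ μ
      ↔ ∀ t < S.N, g.control ξ t =ᵐ[μ] ξ.optCom t + ξ.optLoc μ t) := fun hu => by
    have h_int : ∀ t < S.N, Integrable (g.control ξ t) μ := fun t ht =>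
      (hu t ht).integrable one_le_two
    have hu_lt : ∀ t < S.N, ∀ s < t, MemLp (g.control ξ s) 2 μ := fun t ht s hs =>
      hu s (hs.trans ht)
    calc g.IsFeedback ξ μ
        ↔ ∀ t < S.N, g.devCom ξ μ t =ᵐ[μ] 0 ∧ ∀ i, g.devLoc ξ μ i t =ᵐ[μ] 0 :=
          forall₂_congr fun t ht => and_iff_right (h_int t ht)
      _ ↔ ∀ t < S.N, g.ucom ξ μ t =ᵐ[μ] (fun ω => ξ.comLaw t (g.xcom ξ μ t ω) ω)
            ∧ g.uloc ξ μ t =ᵐ[μ] fun ω => ξ.locLaw μ t (g.xloc ξ μ t ω) ω :=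
          forall₂_congr fun t ht => and_congr
            (Strategy.devCom_ae_eq_zero_iff hξ ht.le (hu_lt t ht))
            (Strategy.devLoc_ae_eq_zero_iff hξ ht.le (hu_lt t ht) (h_int t ht))
      _ ↔ ∀ t < S.N, g.ucom ξ μ t =ᵐ[μ] ξ.optCom t ∧ g.uloc ξ μ t =ᵐ[μ] ξ.optLoc μ t := by
          simp only [forall_and]
          exact and_congr forall_ae_eq_loopControl_iff.symm forall_ae_eq_loopControl_iff.symm
      _ ↔ _ := forall₂_congr fun t ht => (Strategy.control_ae_eq_opt_iff hξ ht.le).symm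
  exact ⟨fun hg => (h_iff fun t ht => hg.memLp_control hξ ht).1 hg, fun h =>
    (h_iff fun t ht => (hξ.memLp_optCom_add_optLoc ht.le).ae_eq (h t ht).symm).2 h⟩

theorem Primitives.Standard.exists_isFeedback (hξ : ξ.Standard μ) :
    ∃ g : Strategy S, g.IsFeedback ξ μ := by
  obtain ⟨g, hg⟩ := hξ.exists_strategy_control_eq_opt (μ := μ)
  exact ⟨g, (Strategy.isFeedback_iff_control_ae_eq hξ).2 fun t ht => .of_eq (hg t ht)⟩

theorem Strategy.IsFeedback.J_eq (hξ : ξ.Standard μ) (hg : g.IsFeedback ξ μ) :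
    g.J ξ μ = ENNReal.ofReal (ξ.minCost μ) := by
  have hu : ∀ t < S.N, MemLp (g.control ξ t) 2 μ := fun t ht => hg.memLp_control hξ ht
  rw [Strategy.J_eq_ofReal hξ hu, (Strategy.isFeedback_iff_excessCost_eq_zero hξ hu).1 hg,
    add_zero]

theorem Strategy.IsFeedback.isOptimal (hξ : ξ.Standard μ) (hg : g.IsFeedback ξ μ) :
    g.IsOptimal ξ μ := fun g' => by
  by_cases hJ : g'.J ξ μ = ⊤
  · exact hJ ▸ le_top
  rw [hg.J_eq hξ, Strategy.J_eq_ofReal hξ fun t ht => memLp_control_of_J_ne_top hξ hJ ht]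
  exact ENNReal.ofReal_le_ofReal (le_add_of_nonneg_right (g'.excessCost_nonneg ξ μ))

theorem Strategy.isOptimal_iff_isFeedback (hξ : ξ.Standard μ) :
    g.IsOptimal ξ μ ↔ g.IsFeedback ξ μ := by
  refine ⟨fun hg => ?_, fun hg => hg.isOptimal hξ⟩
  obtain ⟨g', hg'⟩ := hξ.exists_isFeedback
  have hu' : ∀ t < S.N, MemLp (g'.control ξ t) 2 μ := fun t ht => hg'.memLp_control hξ ht
  have hJ : g.J ξ μ ≤ ENNReal.ofReal (ξ.minCost μ) := (hg g').trans_eq (hg'.J_eq hξ)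
  have hu : ∀ t < S.N, MemLp (g.control ξ t) 2 μ := fun t ht =>
    memLp_control_of_J_ne_top hξ (hJ.trans_lt ENNReal.ofReal_lt_top).ne ht
  have h_min : ∫ ω, g'.pathCost ξ ω ∂μ = ξ.minCost μ := by
    rw [Strategy.integral_pathCost hξ hu', (isFeedback_iff_excessCost_eq_zero hξ hu').1 hg',
      add_zero]
  have h_min_nonneg : 0 ≤ ξ.minCost μ := h_min ▸ integral_nonneg (g'.pathCost_nonneg ξ)
  rw [Strategy.J_eq_ofReal hξ hu, ENNReal.ofReal_le_ofReal_iff h_min_nonneg,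
    add_le_iff_nonpos_right] at hJ
  exact (isFeedback_iff_excessCost_eq_zero hξ hu).2 (hJ.antisymm (g.excessCost_nonneg ξ μ))

end Optimality

/-! ### Uniqueness of the control laws -/

section Uniqueness

variable {n : ℕ} {S : System n} {Ω : Type*}

theorem Primitives.infoMajorOf_congr (ξ : Primitives S Ω) (ω : Ω) {us us' : ℕ → Stacked S.du}
    {t : ℕ} (h : ∀ s < t, us s = us' s) : ξ.infoMajorOf us ω t = ξ.infoMajorOf us' ω t := by
  refine Prod.ext (funext fun s => ?_) (funext fun s => congrArg (blk · none) (h s s.2))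
  exact congrArg (blk · none) (ξ.stateOf_congr ω fun r hr => h r (by omega))

theorem Primitives.infoMinorOf_congr (ξ : Primitives S Ω) (ω : Ω) {us us' : ℕ → Stacked S.du}
    (i : Fin n) {t : ℕ} (h : ∀ s < t, us s = us' s) :
    ξ.infoMinorOf us ω i t = ξ.infoMinorOf us' ω i t := by
  refine Prod.ext (ξ.infoMajorOf_congr ω h) (Prod.ext (funext fun s => ?_)
    (funext fun s => congrArg (blk · (some i)) (h s s.2)))
  have h_state : ξ.stateOf us ω s = ξ.stateOf us' ω s :=
    ξ.stateOf_congr ω fun r hr => h r (by omega)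
  simp only [Primitives.infoMinorOf, Primitives.outputOf, h_state]

variable [MeasurableSpace Ω] {μ : Measure Ω} {ξ : Primitives S Ω} {g g' : Strategy S} {t : ℕ}

theorem Strategy.major_ae_eq (hξ : ξ.Standard μ) (ht : t ≤ S.N)
    (h : ∀ s ≤ t, g.control ξ s =ᵐ[μ] g'.control ξ s) :
    ∀ᵐ I ∂μ.map (g.infoMajor ξ t), g.major t I = g'.major t I := by
  have h_info : Measurable (g.infoMajor ξ t) :=
    ((g.adaptedBefore ξ ht.step).measurable_infoMajorOf ht).mono (hξ.sigInfo_le ht none) le_rfl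
  rw [ae_map_iff h_info.aemeasurable
    (measurableSet_eq_fun (g.measurable_major t) (g'.measurable_major t))]
  filter_upwards [(Set.finite_Iic t).eventually_all.2 h] with ω h
  have h_eq : g.infoMajor ξ t ω = g'.infoMajor ξ t ω :=
    ξ.infoMajorOf_congr ω fun s hs => h s hs.le
  rw [← g.blk_control_none, h t (Set.mem_Iic.2 le_rfl), g'.blk_control_none, h_eq]

theorem Strategy.minor_ae_eq (hξ : ξ.Standard μ) (i : Fin n) (ht : t ≤ S.N)
    (h : ∀ s ≤ t, g.control ξ s =ᵐ[μ] g'.control ξ s) :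
    ∀ᵐ I ∂μ.map (g.infoMinor ξ i t), g.minor i t I = g'.minor i t I := by
  have h_info : Measurable (g.infoMinor ξ i t) :=
    ((g.adaptedBefore ξ ht.step).measurable_infoMinorOf ht i).mono (hξ.sigInfo_le ht _) le_rfl
  rw [ae_map_iff h_info.aemeasurable
    (measurableSet_eq_fun (g.measurable_minor i t) (g'.measurable_minor i t))]
  filter_upwards [(Set.finite_Iic t).eventually_all.2 h] with ω h
  have h_eq : g.infoMinor ξ i t ω = g'.infoMinor ξ i t ω :=
    ξ.infoMinorOf_congr ω i fun s hs => h s hs.le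
  rw [← g.blk_control_some, h t (Set.mem_Iic.2 le_rfl), g'.blk_control_some, h_eq]

end Uniqueness

end MajorMinor

end

theorem mainTheorem3 {n : ℕ} (S : MajorMinor.System n) {Ω : Type*} [MeasurableSpace Ω]
    (μ : MeasureTheory.Measure Ω) [MeasureTheory.IsProbabilityMeasure μ]
    (ξ : MajorMinor.Primitives S Ω) (hξ : ξ.Standard μ) :
    -- an optimal strategy exists, and its cost is finite
    (∃ g : MajorMinor.Strategy S, g.IsOptimal ξ μ ∧ g.J ξ μ ≠ ⊤) ∧
    -- a strategy is optimal exactly when its control split has the stated form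
    (∀ g : MajorMinor.Strategy S, g.IsOptimal ξ μ ↔
      ∀ t < S.N,
        MeasureTheory.Integrable (g.control ξ t) μ ∧
        (∀ᵐ ω ∂μ, g.ucom ξ μ t ω = -(S.Lcom t *ᵥ g.zhatCom ξ μ t ω)) ∧
        ∀ i : Fin n, ∀ᵐ ω ∂μ,
          MajorMinor.blk (g.uloc ξ μ t ω) (some i) = -(S.Lloc i t *ᵥ g.zhatLoc ξ μ i t ω)) ∧
    -- the optimal strategy is unique: as a control process, and as control laws up to null
    -- sets for the distribution of the information
    (∀ g g' : MajorMinor.Strategy S, g.IsOptimal ξ μ → g'.IsOptimal ξ μ →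
      ∀ t < S.N,
        (∀ᵐ ω ∂μ, g.control ξ t ω = g'.control ξ t ω) ∧
        (∀ᵐ I ∂(μ.map (g.infoMajor ξ t)), g.major t I = g'.major t I) ∧
        ∀ i : Fin n, ∀ᵐ I ∂(μ.map (g.infoMinor ξ i t)), g.minor i t I = g'.minor i t I) := by
  have h_iff := fun g : MajorMinor.Strategy S => MajorMinor.Strategy.isOptimal_iff_isFeedback
    (g := g) hξ
  refine ⟨?_, fun g => ?_, fun g g' hg hg' t ht => ?_⟩
  · obtain ⟨g, hg⟩ := hξ.exists_isFeedback
    exact ⟨g, hg.isOptimal hξ, hg.J_eq hξ ▸ ENNReal.ofReal_ne_top⟩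
  · simp only [h_iff, eq_neg_iff_add_eq_zero]
    exact Iff.rfl
  · have h_opt := (MajorMinor.Strategy.isFeedback_iff_control_ae_eq hξ).1 ((h_iff g).1 hg)
    have h_opt' := (MajorMinor.Strategy.isFeedback_iff_control_ae_eq hξ).1 ((h_iff g').1 hg')
    have h_control : ∀ s ≤ t, g.control ξ s =ᵐ[μ] g'.control ξ s := fun s hs =>
      (h_opt s (hs.trans_lt ht)).trans (h_opt' s (hs.trans_lt ht)).symm
    exact ⟨h_control t le_rfl, MajorMinor.Strategy.major_ae_eq hξ ht.le h_control,
      fun i => MajorMinor.Strategy.minor_ae_eq hξ i ht.le h_control⟩
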